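/- Let $M$ be a connected (Hausdorff, second countable, finite-dimensional) smooth manifold with tangent bundle $\pi\colon TM\to M$, and let $(M,L)$ be a Finsler spacetime, that is: $A\subset TM\setminus\mathbf 0$ is open with $\pi(A)=M$; $L\colon A\to(0,\infty)$ is continuous; each $A_p=A\cap T_pM$ is convex and closed under multiplication by positive numbers; $L(\lambda v)=\lambda^2L(v)$ for $\lambda>0$; $A$ has smooth boundary in $TM\setminus\mathbf 0$; $\bar A$ contains no line; $\{v\in A_p: L(v)\ge 1\}$ is convex for every $p$; and $L$ extends, still positively homogeneous of degree $2$, to a conic open set $A^*\subset TM\setminus\mathbf 0$ containing $\hat A:=\bar A\setminus\mathbf 0$, so that $L=0$ on $\partial A\setminus\mathbf 0$ and so that, on a neighbourhood of $\partial A\setminus\mathbf 0$, $L$ is smooth with nondegenerate fundamental tensor $g_v(u,w)=\frac12\frac{\partial^2}{\partial s\partial t}L(v+tu+sw)\big|_{t=s=0}$. Call $v\in A^*$ regular if $L$ is smooth near $v$ and $g_v$ is nondegenerate. For a vector field $V$ with regular values, the Chern connection $\nabla^V$ is the torsion-free affine connection with $$X\big(g_V(Y,Z)\big)=g_V(\nabla^V_XY,Z)+g_V(Y,\nabla^V_XZ)+2C_V(\nabla^V_XV,Y,Z),\qquad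 C_v(w_1,w_2,w_3)=\tfrac14\frac{\partial^3}{\partial s_3\partial s_2\partial s_1}L\Big(v+\sum_i s_iw_i\Big)\Big|_{s=0},$$ and $D_\gamma^W$ denotes the induced covariant derivative along a curve $\gamma$ with reference vector $W$ (a field of regular vectors along $\gamma$). Let $a<b$ and let $\sigma\colon[a,b]\to M$ be a geodesic of $(M,L)$: a smooth curve whose velocities $\dot\sigma(u)$ are regular vectors of $\hat A$ and which satisfies $D_\sigma^{\dot\sigma}\dot\sigma=0$. Let $a=t_0<t_1<\dots<t_k=b$ be a partition, and let $V$ and $B$ be continuous vector fields along $\sigma$ that are smooth on each $[t_i,t_{i+1}]$ (for $k=1$: smooth vector fields along $\sigma$), with $V(a)=V(b)=0=B(a)=B(b)$. Then there are $\delta>0$ and a continuous variation $x\colon[a,b]\times(-\delta,\delta)\to M$ of $\sigma$, i.e. $x(u,0)=\sigma(u)$, smooth on each $[t_i,t_{i+1}]\times(-\delta,\delta)$ (for $k=1$: a smooth variation), which fixes the endpoints, $x(a,v)=\sigma(a)$ and $x(b,v)=\sigma(b)$ for all $v$, and which has variation field $V$ and acceleration field $B$: writing $\sigma_v=x(\cdot,v)$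 and $\beta_u=x(u,\cdot)$, the velocities $\dot\sigma_v(u)$ (one-sided at the $t_i$) are all regular, and for all $u\in[a,b]$ $$\dot\beta_u|_{v=0}=V(u),\qquad D_{\beta_u}^{\dot\sigma_v}\dot\beta_u\big|_{v=0}=B(u).$$ -/

import Mathlib

open Set Filter Topology
open scoped Manifold ContDiff

noncomputable section

namespace Finsler

section Vertical

variable {E : Type*} [AddCommGroup E] [Module ℝ E]

/-- For a function `f` on a vector space, `(1/2) ∂²/∂s∂t f (v + t u + s w)` at `s = t = 0`. -/
def halfHess (f : E → ℝ) (v u w : E) : ℝ :=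
  (1 / 2) * deriv (fun s : ℝ => deriv (fun t : ℝ => f (v + t • u + s • w)) 0) 0

/-- For a function `f` on a vector space,
`(1/4) ∂³/∂s₃∂s₂∂s₁ f (v + s₁ w₁ + s₂ w₂ + s₃ w₃)` at `s₁ = s₂ = s₃ = 0`. -/
def quarterThird (f : E → ℝ) (v w₁ w₂ w₃ : E) : ℝ :=
  (1 / 4) * deriv (fun s₃ : ℝ => deriv (fun s₂ : ℝ => deriv (fun s₁ : ℝ =>
    f (v + s₁ • w₁ + s₂ • w₂ + s₃ • w₃)) 0) 0) 0

end Vertical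

section Chern

variable {E : Type*} [NormedAddCommGroup E] [NormedSpace ℝ E]
  {M : Type*} [TopologicalSpace M] [ChartedSpace E M] [IsManifold 𝓘(ℝ, E) ∞ M]

/-- The fundamental tensor `g_v(u, w)` of `L`, at `v ∈ TM`, for `u, w ∈ T_{π(v)} M`. -/
def fundTensor (L : TangentBundle 𝓘(ℝ, E) M → ℝ) (v : TangentBundle 𝓘(ℝ, E) M)
    (u w : TangentSpace 𝓘(ℝ, E) v.proj) : ℝ :=
  halfHess (fun z : TangentSpace 𝓘(ℝ, E) v.proj => L ⟨v.proj, z⟩) v.snd u w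

/-- `L` is smooth in a neighbourhood of `v` and `g_v` is nondegenerate. -/
def IsRegularAt (L : TangentBundle 𝓘(ℝ, E) M → ℝ) (v : TangentBundle 𝓘(ℝ, E) M) : Prop :=
  (∀ᶠ w in 𝓝 v, ContMDiffAt 𝓘(ℝ, E).tangent 𝓘(ℝ, ℝ) ∞ L w) ∧
    ∀ u : TangentSpace 𝓘(ℝ, E) v.proj, (∀ w, fundTensor L v u w = 0) → u = 0

/-- The chart of `TM` with values in `E × E` induced by the preferred chart of `M` at `p`: a
vector `w` at a point `q` near `p` goes to (coordinates of `q`, components of `w`).  Over `p`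
itself, the components of `w ∈ T_p M` are `w`, as `TangentSpace 𝓘(ℝ, E) p` is by
definition `E`. -/
def tangentChart (p : M) : PartialEquiv (TangentBundle 𝓘(ℝ, E) M) (E × E) :=
  extChartAt 𝓘(ℝ, E).tangent (⟨p, 0⟩ : TangentBundle 𝓘(ℝ, E) M)

/-- `L` in the coordinates around `p`: `y` are coordinates of the base point and `w` the
components of the vector. -/
def localL (L : TangentBundle 𝓘(ℝ, E) M → ℝ) (p : M) (y w : E) : ℝ :=
  L ((tangentChart p).symm (y, w))

/-- `Γ` is the bilinear map of Christoffel symbols of the Chern connection of `L` with reference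
vector `v`, in the preferred coordinates at `p = π(v)`.  The first condition says that the
connection is torsion-free, the second one that it is almost compatible with `g`:
`X (g_V(Y, Z)) = g_V(∇^V_X Y, Z) + g_V(Y, ∇^V_X Z) + 2 C_V(∇^V_X V, Y, Z)`
at `p`, where `V` is the extension of `v` with constant components, and
`X, Y, Z` have constant components `a, b, c` (so that `∇^V_X V = Γ(a, v)`, and so on).
If `L` is homogeneous and smooth near `v` and `g_v` is nondegenerate then there is exactly one
such `Γ`. -/
def IsChernSymbol (L : TangentBundle 𝓘(ℝ, E) M → ℝ) (v : TangentBundle 𝓘(ℝ, E) M)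
    (Γ : E →L[ℝ] E →L[ℝ] E) : Prop :=
  let p : M := v.proj
  let y₀ : E := extChartAt 𝓘(ℝ, E) p p
  let w₀ : E := v.snd
  let g : E → E → E → ℝ := fun y b c => halfHess (localL L p y) w₀ b c
  let C : E → E → E → ℝ := quarterThird (localL L p y₀) w₀
  (∀ a b : E, Γ a b = Γ b a) ∧
    ∀ a b c : E, deriv (fun s : ℝ => g (y₀ + s • a) b c) 0 =
      g y₀ (Γ a b) c + g y₀ b (Γ a c) + 2 * C (Γ a w₀) b c

open Classical in
/-- The Christoffel symbols of the Chern connection with reference vector `v`. -/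
def chernSymbol (L : TangentBundle 𝓘(ℝ, E) M → ℝ) (v : TangentBundle 𝓘(ℝ, E) M) :
    E →L[ℝ] E →L[ℝ] E :=
  if h : ∃ Γ, IsChernSymbol L v Γ then h.choose else 0

/-- The velocity of the curve `γ`, defined on `s ⊆ ℝ`, at `t`. -/
def velocity (γ : ℝ → M) (s : Set ℝ) (t : ℝ) : TangentSpace 𝓘(ℝ, E) (γ t) :=
  mfderivWithin 𝓘(ℝ, ℝ) 𝓘(ℝ, E) γ s t (1 : ℝ)

/-- The covariant derivative `D_γ^W X` at `t₀` given by the Chern connection, where `W` and `X`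
are vector fields along the curve `γ`, which is defined on `s ⊆ ℝ`.  In coordinates it is
`X' + Γ_W(γ', X)`. -/
def covDeriv (L : TangentBundle 𝓘(ℝ, E) M → ℝ) (γ : ℝ → M) (s : Set ℝ)
    (W X : (t : ℝ) → TangentSpace 𝓘(ℝ, E) (γ t)) (t₀ : ℝ) : TangentSpace 𝓘(ℝ, E) (γ t₀) :=
  let dX : E := derivWithin
    (fun t : ℝ => (tangentChart (γ t₀) (⟨γ t, X t⟩ : TangentBundle 𝓘(ℝ, E) M)).2) s t₀
  let ΓX : E := chernSymbol L (⟨γ t₀, W t₀⟩ : TangentBundle 𝓘(ℝ, E) M)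
    (velocity (E := E) γ s t₀) (X t₀)
  dX + ΓX

end Chern

/-- A Finsler spacetime on the manifold `M`: an open cone bundle `A ⊆ TM ∖ 0` with a positive
function `L` on it which is zero on the boundary, together with an extension of `L` to a conic
open set `Astar` that contains the closure of `A` in `TM ∖ 0`.  The values of `L` outside
`Astar` are irrelevant. -/
structure FinslerSpacetime (E : Type*) [NormedAddCommGroup E] [NormedSpace ℝ E]
    (M : Type*) [TopologicalSpace M] [ChartedSpace E M] [IsManifold 𝓘(ℝ, E) ∞ M] where
  /-- The open set of timelike directions. -/
  A : Set (TangentBundle 𝓘(ℝ, E) M)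
  /-- The domain of the extension of `L`. -/
  Astar : Set (TangentBundle 𝓘(ℝ, E) M)
  /-- The Lorentz-Finsler metric. -/
  L : TangentBundle 𝓘(ℝ, E) M → ℝ
  isOpen_A : IsOpen A
  ne_zero_of_mem_A : ∀ v ∈ A, v.snd ≠ 0
  proj_A : ∀ p : M, ∃ v ∈ A, v.proj = p
  continuousOn_L : ContinuousOn L A
  pos_L : ∀ v ∈ A, 0 < L v
  convex_A : ∀ p : M, Convex ℝ
    {v : TangentSpace 𝓘(ℝ, E) p | (⟨p, v⟩ : TangentBundle 𝓘(ℝ, E) M) ∈ A}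
  conic_A : ∀ v ∈ A, ∀ r : ℝ, 0 < r → (⟨v.proj, r • v.snd⟩ : TangentBundle 𝓘(ℝ, E) M) ∈ A
  /-- `A` has smooth boundary in `TM ∖ 0`: locally it is the positivity set of a smooth function
  with nonzero differential. -/
  smooth_boundary : ∀ v ∈ frontier A, v.snd ≠ 0 →
    ∃ (O : Set (TangentBundle 𝓘(ℝ, E) M)) (f : TangentBundle 𝓘(ℝ, E) M → ℝ),
      IsOpen O ∧ v ∈ O ∧ ContMDiffOn 𝓘(ℝ, E).tangent 𝓘(ℝ, ℝ) ∞ f O ∧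
      mfderiv 𝓘(ℝ, E).tangent 𝓘(ℝ, ℝ) f v ≠ 0 ∧ A ∩ O = {w ∈ O | 0 < f w}
  L_boundary : ∀ v ∈ frontier A, v.snd ≠ 0 → L v = 0
  /-- The closure of `A` contains no lines. -/
  salient : ∀ (p : M) (v : TangentSpace 𝓘(ℝ, E) p), v ≠ 0 →
    (⟨p, v⟩ : TangentBundle 𝓘(ℝ, E) M) ∈ closure A →
    (⟨p, -v⟩ : TangentBundle 𝓘(ℝ, E) M) ∉ closure A
  convex_indicatrix : ∀ p : M, Convex ℝ
    {v : TangentSpace 𝓘(ℝ, E) p | (⟨p, v⟩ : TangentBundle 𝓘(ℝ, E) M) ∈ A ∧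
      1 ≤ L (⟨p, v⟩ : TangentBundle 𝓘(ℝ, E) M)}
  isOpen_Astar : IsOpen Astar
  ne_zero_of_mem_Astar : ∀ v ∈ Astar, v.snd ≠ 0
  conic_Astar : ∀ v ∈ Astar, ∀ r : ℝ, 0 < r →
    (⟨v.proj, r • v.snd⟩ : TangentBundle 𝓘(ℝ, E) M) ∈ Astar
  closure_subset_Astar : ∀ v ∈ closure A, v.snd ≠ 0 → v ∈ Astar
  homogeneous_L : ∀ v ∈ Astar, ∀ r : ℝ, 0 < r →
    L (⟨v.proj, r • v.snd⟩ : TangentBundle 𝓘(ℝ, E) M) = r ^ 2 * L v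
  /-- Near the boundary of `A` in `TM ∖ 0`, the function `L` is smooth and its fundamental tensor
  is nondegenerate. -/
  regular_near_boundary : ∃ U : Set (TangentBundle 𝓘(ℝ, E) M), IsOpen U ∧ U ⊆ Astar ∧
    (∀ v ∈ frontier A, v.snd ≠ 0 → v ∈ U) ∧ ∀ v ∈ U, IsRegularAt L v

section Curves

variable {E : Type*} [NormedAddCommGroup E] [NormedSpace ℝ E]
  {M : Type*} [TopologicalSpace M] [ChartedSpace E M] [IsManifold 𝓘(ℝ, E) ∞ M]

/-- `σ : [a, b] → M` is a geodesic of the Finsler spacetime: it is smooth, its velocities are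
nonzero vectors in the closure of `A` at which `L` is smooth with nondegenerate
fundamental tensor, and `D_σ^{σ'} σ' = 0`. -/
def FinslerSpacetime.IsGeodesic (F : FinslerSpacetime E M) (σ : ℝ → M) (a b : ℝ) : Prop :=
  ContMDiffOn 𝓘(ℝ, ℝ) 𝓘(ℝ, E) ∞ σ (Icc a b) ∧
  ∀ u ∈ Icc a b,
    velocity (E := E) σ (Icc a b) u ≠ 0 ∧
    (⟨σ u, velocity σ (Icc a b) u⟩ : TangentBundle 𝓘(ℝ, E) M) ∈ closure F.A ∧
    IsRegularAt F.L (⟨σ u, velocity σ (Icc a b) u⟩ : TangentBundle 𝓘(ℝ, E) M) ∧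
    covDeriv F.L σ (Icc a b) (velocity σ (Icc a b)) (velocity σ (Icc a b)) u = 0

/-- `t 0 = a < t 1 < ⋯ < t k = b` is a partition of `[a, b]`. -/
def IsPartition (a b : ℝ) (k : ℕ) (t : ℕ → ℝ) : Prop :=
  t 0 = a ∧ t k = b ∧ ∀ i < k, t i < t (i + 1)

/-- The `i`-th closed interval of a partition. -/
def piece (t : ℕ → ℝ) (i : ℕ) : Set ℝ := Icc (t i) (t (i + 1))

/-- `V` is a continuous vector field along `σ` that is smooth on every closed interval of the
partition `t`; for `k = 1` it is a smooth vector field along `σ`. -/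
def IsPiecewiseSmoothField (σ : ℝ → M) (k : ℕ) (t : ℕ → ℝ)
    (V : (u : ℝ) → TangentSpace 𝓘(ℝ, E) (σ u)) : Prop :=
  ∀ i < k, ContMDiffOn 𝓘(ℝ, ℝ) 𝓘(ℝ, E).tangent ∞
    (fun u => (⟨σ u, V u⟩ : TangentBundle 𝓘(ℝ, E) M)) (piece t i)

variable (E) in
/-- `x : [a, b] × (-δ, δ) → M` is a (continuous) variation of `σ : [a, b] → M` that is smooth on
`[t i, t (i + 1)] × (-δ, δ)` for every interval of the partition `t`; for `k = 1` it is a smooth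
variation. -/
def IsPiecewiseSmoothVariation (σ : ℝ → M) (k : ℕ) (t : ℕ → ℝ) (δ : ℝ) (x : ℝ × ℝ → M) : Prop :=
  (∀ i < k, ContMDiffOn 𝓘(ℝ, ℝ × ℝ) 𝓘(ℝ, E) ∞ x (piece t i ×ˢ Ioo (-δ) δ)) ∧
    ∀ i < k, ∀ u ∈ piece t i, x (u, 0) = σ u

/-- The velocity at `u` of the longitudinal curve `x (·, v)`, as a curve on
the set `s`. -/
def longVelocity (x : ℝ × ℝ → M) (s : Set ℝ) (u v : ℝ) : TangentSpace 𝓘(ℝ, E) (x (u, v)) :=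
  velocity (fun u' => x (u', v)) s u

/-- The velocity at `v` of the transverse curve `x (u, ·) : (-δ, δ) → M`. -/
def transVelocity (x : ℝ × ℝ → M) (δ u v : ℝ) : TangentSpace 𝓘(ℝ, E) (x (u, v)) :=
  velocity (fun v' => x (u, v')) (Ioo (-δ) δ) v

/-- The acceleration field of the variation `x` at `u`: the covariant derivative at `v = 0` of
the velocity of the transverse curve `x (u, ·)` along this curve, with the velocities of the
longitudinal curves, considered on the set `s`, as reference vectors. -/
def accelField (L : TangentBundle 𝓘(ℝ, E) M → ℝ) (x : ℝ × ℝ → M) (s : Set ℝ) (δ u : ℝ) :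
    TangentSpace 𝓘(ℝ, E) (x (u, 0)) :=
  covDeriv L (fun v => x (u, v)) (Ioo (-δ) δ) (fun v => longVelocity x s u v)
    (fun v => transVelocity x δ u v) 0

end Curves

end Finsler

end

/-! In coordinates the acceleration of a variation of `σ` at `v = 0` is the second `v`-derivative
plus `Γ(V, V)`, where `V` is the variation field and the Christoffel symbol `Γ` is taken at the
velocity of `σ` itself. Hence `Γ(V, V)` depends on the variation only through `V`, and adding `(v² /
2) W` to a variation keeps `V` and adds `W` to the acceleration. Two corrections of the constant
variation therefore suffice: first `v V`, then `(v² / 2) B`, where `B` is the prescribed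
acceleration field `A` minus the acceleration field reached so far.

Adding a vector to a point makes sense only in a chart. So `[a, b]` gets a finite partition of unity
`χ j` whose supports are mapped by `σ` into chart domains, and the variation is displaced by `χ j u
* f v` times `W u` in one chart after another (`exists_displacement`, `exists_variation_add`). At `v
= 0` the first-order changes are tangent vectors at `σ u`, and so are the second-order changes if
`f' 0 = 0` (`deriv_deriv_comp_perturbation`); they add up to the right multiple of `W u` because `∑
χ j = 1`.

The main work is to show that `B` is smooth on every piece. `chernSymbol` is chosen point by point,
in a chart that moves with the base point. A Koszul formula gives existence, uniqueness and smooth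
dependence of the symbol in a fixed chart (`ChernData.koszulOp_injective`, `contDiffAt_algChern`),
and `IsLocalChern.coordChange` gives its transformation law. Together they express the acceleration
smoothly in a fixed chart (`vecComp_acceleration`, `hasSmoothComp_centralAccel`).

Regularity of the velocities is an open condition, so compactness yields it for small `v`. A
displacement does nothing where `W` vanishes, which fixes the endpoints. -/

set_option maxSynthPendingDepth 3

noncomputable section

namespace Finsler

/-! ### Linear algebra of the Chern connection: the Koszul formula and its solution. -/

section ChernAlgebra

variable {E : Type*} [NormedAddCommGroup E] [NormedSpace ℝ E]

/-- A family of continuous linear maps on a finite-dimensional space is `C^n` at a point if all its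
applications are. -/
lemma contDiffAt_of_clm_apply {D F : Type*} [NormedAddCommGroup D] [NormedSpace ℝ D]
    [NormedAddCommGroup F] [NormedSpace ℝ F] [FiniteDimensional ℝ E] {n : WithTop ℕ∞}
    {f : D → E →L[ℝ] F} {x : D} (h : ∀ y, ContDiffAt ℝ n (fun x => f x y) x) :
    ContDiffAt ℝ n f x := by
  let d := Module.finrank ℝ E
  have hd : d = Module.finrank ℝ (Fin d → ℝ) := (Module.finrank_fin_fun ℝ).symm
  let e₁ := ContinuousLinearEquiv.ofFinrankEq hd
  let e₂ := (e₁.arrowCongr (1 : F ≃L[ℝ] F)).trans (ContinuousLinearEquiv.piRing (Fin d))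
  rw [← Function.id_comp f, ← e₂.symm_comp_self]
  exact e₂.symm.contDiff.contDiffAt.comp x (contDiffAt_pi.mpr fun i => h _)

/-- From `R a b c` to `R a b c + R b a c - R c a b`. -/
def koszulSum (R : E →L[ℝ] E →L[ℝ] E →L[ℝ] ℝ) : E →L[ℝ] E →L[ℝ] E →L[ℝ] ℝ :=
  R + R.flip -
    ((ContinuousLinearMap.flipₗᵢ ℝ E E ℝ).toContinuousLinearEquiv :
      (E →L[ℝ] E →L[ℝ] ℝ) →L[ℝ] (E →L[ℝ] E →L[ℝ] ℝ)).comp R.flip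

lemma koszulSum_apply (R : E →L[ℝ] E →L[ℝ] E →L[ℝ] ℝ) (a b c : E) :
    koszulSum R a b c = R a b c + R b a c - R c a b := rfl

/-- The left-hand side of the Koszul formula of the Chern connection, as a linear map of the
Christoffel symbols `Γ`; `G` is the fundamental tensor, `Q` twice the Cartan tensor and `w` the
reference vector. -/
def koszulOp (G : E →L[ℝ] E →L[ℝ] ℝ) (Q : E →L[ℝ] E →L[ℝ] E →L[ℝ] ℝ) (w : E) :
    (E →L[ℝ] E →L[ℝ] E) →ₗ[ℝ] (E →L[ℝ] E →L[ℝ] E →L[ℝ] ℝ) where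
  toFun Γ := (2 : ℝ) • (ContinuousLinearMap.compL ℝ E E (E →L[ℝ] ℝ) G).comp Γ +
    koszulSum (Q.comp (Γ.flip w))
  map_add' Γ Γ' := by
    ext a b c
    simp [koszulSum_apply]
    ring
  map_smul' r Γ := by
    ext a b c
    simp [koszulSum_apply]
    ring

lemma koszulOp_apply (G : E →L[ℝ] E →L[ℝ] ℝ) (Q : E →L[ℝ] E →L[ℝ] E →L[ℝ] ℝ) (w : E)
    (Γ : E →L[ℝ] E →L[ℝ] E) (a b c : E) :
    koszulOp G Q w Γ a b c = 2 * G (Γ a b) c +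
      (Q (Γ a w) b c + Q (Γ b w) a c - Q (Γ c w) a b) := rfl

/-- The algebraic condition on Christoffel symbols of the Chern connection, in terms of the
fundamental tensor `G`, its horizontal derivative `P` and its vertical derivative `Q`. -/
def IsAlgChern (G : E →L[ℝ] E →L[ℝ] ℝ) (P Q : E →L[ℝ] E →L[ℝ] E →L[ℝ] ℝ) (w : E)
    (Γ : E →L[ℝ] E →L[ℝ] E) : Prop :=
  (∀ a b, Γ a b = Γ b a) ∧
    ∀ a b c, P a b c = G (Γ a b) c + G b (Γ a c) + Q (Γ a w) b c

/-- The symmetries of the fundamental tensor `G`, of its horizontal derivative `P` and of its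
vertical derivative `Q` at the vector `w`, and nondegeneracy. -/
structure ChernData (G : E →L[ℝ] E →L[ℝ] ℝ) (P Q : E →L[ℝ] E →L[ℝ] E →L[ℝ] ℝ) (w : E) : Prop where
  symm_G : ∀ a b, G a b = G b a
  nondeg : ∀ a, (∀ b, G a b = 0) → a = 0
  symm_P : ∀ a b c, P a b c = P a c b
  symm_Q : ∀ a b c, Q a b c = Q a c b
  symm_Q' : ∀ a b c, Q a b c = Q b a c
  Q_self : ∀ a b, Q w a b = 0

variable {G : E →L[ℝ] E →L[ℝ] ℝ} {P Q : E →L[ℝ] E →L[ℝ] E →L[ℝ] ℝ} {w : E}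

lemma ChernData.eq_of_forall (h : ChernData G P Q w) {u v : E} (huv : ∀ c, G u c = G v c) :
    u = v := by
  refine sub_eq_zero.1 (h.nondeg _ fun c => ?_)
  rw [map_sub, sub_apply, huv, sub_self]

/-- The usual Koszul trick. Combining compatibility for `(a, b, c)`, `(b, a, c)` and `(c, a, b)`
cancels all metric terms but `2 G(Γ(a, b), c)`. Conversely, exchanging `a` and `b` in the formula
gives torsion-freeness, and adding the formulas for `(a, b, c)` and `(a, c, b)` gives back
compatibility. -/
lemma ChernData.isAlgChern_iff (h : ChernData G P Q w) (Γ : E →L[ℝ] E →L[ℝ] E) :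
    IsAlgChern G P Q w Γ ↔ koszulOp G Q w Γ = koszulSum P := by
  constructor
  · rintro ⟨h1, h2⟩
    ext a b c
    rw [koszulOp_apply, koszulSum_apply, h2 a b c, h2 b a c, h2 c a b, h1 b a, h1 c a, h1 c b,
      h.symm_G b, h.symm_G (Γ a c) b, h.symm_G a]
    ring
  · intro hT
    have key : ∀ a b c, 2 * G (Γ a b) c + (Q (Γ a w) b c + Q (Γ b w) a c - Q (Γ c w) a b) =
        P a b c + P b a c - P c a b := fun a b c => by
      rw [← koszulOp_apply, hT, koszulSum_apply]
    refine ⟨fun a b => h.eq_of_forall fun c => ?_, fun a b c => ?_⟩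
    · have h1 := key a b c
      have h2 := key b a c
      rw [h.symm_Q _ b a, h.symm_P _ b a] at h2
      linarith
    · have h1 := key a b c
      have h2 := key a c b
      rw [h.symm_Q _ c b, h.symm_P _ c b] at h2
      rw [h.symm_G b]
      linarith

/-- The unknown `Γ` also enters through the Cartan terms, but `Q` vanishes as soon as one argument
is `w`, so the system is triangular: it determines `Γ(w, w)`, then `Γ(a, w)`, then `Γ(a, b)`. -/
lemma ChernData.koszulOp_injective (h : ChernData G P Q w) :
    Function.Injective (koszulOp G Q w) := by
  rw [injective_iff_map_eq_zero]
  intro Γ hΓ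
  have key : ∀ a b c, 2 * G (Γ a b) c + (Q (Γ a w) b c + Q (Γ b w) a c - Q (Γ c w) a b) = 0 :=
    fun a b c => by rw [← koszulOp_apply, hΓ]; rfl
  have hw1 : ∀ a b, Q a w b = 0 := fun a b => by rw [h.symm_Q', h.Q_self]
  have hw2 : ∀ a b, Q a b w = 0 := fun a b => by rw [h.symm_Q, hw1]
  have h1 : Γ w w = 0 := h.nondeg _ fun c => by
    have := key w w c
    rw [hw1, hw1] at this
    linarith
  have h2 : ∀ a, Γ a w = 0 := fun a => h.nondeg _ fun c => by
    have := key a w c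
    rw [h1, hw1, hw2, map_zero] at this
    simp only [zero_apply] at this
    linarith
  ext a b
  refine h.nondeg _ fun c => ?_
  have := key a b c
  rw [h2, h2, h2, map_zero] at this
  simp only [zero_apply] at this
  linarith

lemma ChernData.isAlgChern_unique (h : ChernData G P Q w) {Γ Γ' : E →L[ℝ] E →L[ℝ] E}
    (hΓ : IsAlgChern G P Q w Γ) (hΓ' : IsAlgChern G P Q w Γ') : Γ = Γ' :=
  h.koszulOp_injective (((h.isAlgChern_iff Γ).1 hΓ).trans ((h.isAlgChern_iff Γ').1 hΓ').symm)

variable [FiniteDimensional ℝ E]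

/-- Existence by counting dimensions: `E` and its dual have the same dimension, hence so do the
source and the target of `koszulOp`. The equivalence `e'` serves only this count. -/
lemma isInvertible_koszulOp (hnd : Function.Injective (koszulOp G Q w)) :
    (LinearMap.toContinuousLinearMap (koszulOp G Q w)).IsInvertible := by
  have hdim : Module.finrank ℝ E = Module.finrank ℝ (E →L[ℝ] ℝ) := by
    rw [← LinearEquiv.finrank_eq (LinearMap.toContinuousLinearMap (E := E) (F' := ℝ) (𝕜 := ℝ))]
    exact Subspace.dual_finrank_eq.symm
  let e : E ≃L[ℝ] (E →L[ℝ] ℝ) := ContinuousLinearEquiv.ofFinrankEq hdim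
  let e' : (E →L[ℝ] E →L[ℝ] E) ≃L[ℝ] (E →L[ℝ] E →L[ℝ] E →L[ℝ] ℝ) :=
    (ContinuousLinearEquiv.refl ℝ E).arrowCongr ((ContinuousLinearEquiv.refl ℝ E).arrowCongr e)
  exact ⟨(LinearEquiv.ofInjectiveOfFinrankEq _ hnd e'.toLinearEquiv.finrank_eq).toContinuousLinearEquiv,
    by ext; rfl⟩

/-- The solution of the Koszul formula of the Chern connection. -/
def algChern (G : E →L[ℝ] E →L[ℝ] ℝ) (P Q : E →L[ℝ] E →L[ℝ] E →L[ℝ] ℝ) (w : E) :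
    E →L[ℝ] E →L[ℝ] E :=
  (LinearMap.toContinuousLinearMap (koszulOp G Q w)).inverse (koszulSum P)

lemma ChernData.isInvertible (h : ChernData G P Q w) :
    (LinearMap.toContinuousLinearMap (koszulOp G Q w)).IsInvertible :=
  isInvertible_koszulOp h.koszulOp_injective

lemma ChernData.isAlgChern_algChern (h : ChernData G P Q w) :
    IsAlgChern G P Q w (algChern G P Q w) := by
  rw [h.isAlgChern_iff]
  obtain ⟨e, he⟩ := h.isInvertible
  have : koszulOp G Q w (algChern G P Q w) =
      LinearMap.toContinuousLinearMap (koszulOp G Q w) (algChern G P Q w) := rfl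
  rw [this, algChern, ← he, ContinuousLinearMap.inverse_equiv]
  simp

/-- The coefficients of the linear system are smooth, and inversion of operators is smooth at an
invertible one. Invertibility is needed only at `z`. -/
lemma contDiffAt_algChern {D : Type*} [NormedAddCommGroup D] [NormedSpace ℝ D] {n : WithTop ℕ∞}
    {G : D → E →L[ℝ] E →L[ℝ] ℝ} {P Q : D → E →L[ℝ] E →L[ℝ] E →L[ℝ] ℝ} {w : D → E} {z : D}
    (hG : ContDiffAt ℝ n G z) (hP : ContDiffAt ℝ n P z) (hQ : ContDiffAt ℝ n Q z)
    (hw : ContDiffAt ℝ n w z) (h : ChernData (G z) (P z) (Q z) (w z)) :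
    ContDiffAt ℝ n (fun z => algChern (G z) (P z) (Q z) (w z)) z := by
  unfold algChern
  refine ContDiffAt.clm_apply ?_ ?_
  · refine ContDiffAt.comp (g := ContinuousLinearMap.inverse)
      (f := fun z => LinearMap.toContinuousLinearMap (koszulOp (G z) (Q z) (w z))) z
      h.isInvertible.contDiffAt_map_inverse ?_
    refine contDiffAt_of_clm_apply fun Γ => contDiffAt_of_clm_apply fun a =>
      contDiffAt_of_clm_apply fun b => contDiffAt_of_clm_apply fun c => ?_
    have : (fun x => LinearMap.toContinuousLinearMap (koszulOp (G x) (Q x) (w x)) Γ a b c) =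
        fun x => 2 * G x (Γ a b) c +
          (Q x (Γ a (w x)) b c + Q x (Γ b (w x)) a c - Q x (Γ c (w x)) a b) := rfl
    rw [this]
    fun_prop
  · refine contDiffAt_of_clm_apply fun a =>
      contDiffAt_of_clm_apply fun b => contDiffAt_of_clm_apply fun c => ?_
    simp only [koszulSum_apply]
    fun_prop

end ChernAlgebra

/-! ### The fundamental and Cartan tensors in coordinates, as Fréchet derivatives. -/

section LocalTheory

variable {E : Type*} [NormedAddCommGroup E] [NormedSpace ℝ E]

/-- The fundamental tensor of `ℓ : E × E → ℝ`, as half the second derivative in the second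
variable. -/
def vertHess (ℓ : E × E → ℝ) (z : E × E) : E →L[ℝ] E →L[ℝ] ℝ :=
  (1 / 2 : ℝ) • (fderiv ℝ (fderiv ℝ ℓ) z).bilinearComp (.inr ℝ E E) (.inr ℝ E E)

/-- The derivative of the fundamental tensor in the first variable. -/
def horDeriv (ℓ : E × E → ℝ) (z : E × E) : E →L[ℝ] E →L[ℝ] E →L[ℝ] ℝ :=
  (fderiv ℝ (vertHess ℓ) z).comp (.inl ℝ E E)

/-- The derivative of the fundamental tensor in the second variable. -/
def vertDeriv (ℓ : E × E → ℝ) (z : E × E) : E →L[ℝ] E →L[ℝ] E →L[ℝ] ℝ :=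
  (fderiv ℝ (vertHess ℓ) z).comp (.inr ℝ E E)

lemma vertHess_apply (ℓ : E × E → ℝ) (z : E × E) (b c : E) :
    vertHess ℓ z b c = (1 / 2 : ℝ) * fderiv ℝ (fderiv ℝ ℓ) z (0, b) (0, c) := rfl

lemma horDeriv_apply (ℓ : E × E → ℝ) (z : E × E) (a b c : E) :
    horDeriv ℓ z a b c = fderiv ℝ (vertHess ℓ) z (a, 0) b c := rfl

lemma vertDeriv_apply (ℓ : E × E → ℝ) (z : E × E) (a b c : E) :
    vertDeriv ℓ z a b c = fderiv ℝ (vertHess ℓ) z (0, a) b c := rfl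

/-- The function `ℓ` is smooth in a neighbourhood of `z`. -/
def SmoothNear (ℓ : E × E → ℝ) (z : E × E) : Prop := ∀ᶠ z' in 𝓝 z, ContDiffAt ℝ ∞ ℓ z'

variable {ℓ : E × E → ℝ} {z : E × E}

lemma SmoothNear.contDiffAt (h : SmoothNear ℓ z) : ContDiffAt ℝ ∞ ℓ z := h.self_of_nhds

lemma SmoothNear.eventually (h : SmoothNear ℓ z) : ∀ᶠ z' in 𝓝 z, SmoothNear ℓ z' :=
  eventually_eventually_nhds.2 h

lemma two_le_infty : (2 : WithTop ℕ∞) ≤ ∞ :=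
  WithTop.coe_le_coe.2 (le_top : (2 : ℕ∞) ≤ ⊤)

lemma one_le_infty : (1 : WithTop ℕ∞) ≤ ∞ :=
  WithTop.coe_le_coe.2 (le_top : (1 : ℕ∞) ≤ ⊤)

lemma contDiffAt_fderiv_top {F F' : Type*} [NormedAddCommGroup F] [NormedSpace ℝ F]
    [NormedAddCommGroup F'] [NormedSpace ℝ F'] {f : F → F'} {x : F}
    (h : ContDiffAt ℝ ∞ f x) : ContDiffAt ℝ ∞ (fderiv ℝ f) x :=
  h.fderiv_right (by simp)

lemma ContDiffAt.differentiableAt_top {F F' : Type*} [NormedAddCommGroup F] [NormedSpace ℝ F]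
    [NormedAddCommGroup F'] [NormedSpace ℝ F'] {f : F → F'} {x : F}
    (h : ContDiffAt ℝ ∞ f x) : DifferentiableAt ℝ f x :=
  h.differentiableAt (by simp)

lemma hasDerivAt_comp_line {F F' : Type*} [NormedAddCommGroup F] [NormedSpace ℝ F]
    [NormedAddCommGroup F'] [NormedSpace ℝ F'] {f : F → F'} {x : F}
    (h : DifferentiableAt ℝ f x) (d : F) :
    HasDerivAt (fun s : ℝ => f (x + s • d)) (fderiv ℝ f x d) 0 := by
  have h1 : HasDerivAt (fun s : ℝ => x + s • d) d 0 := by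
    simpa using ((hasDerivAt_id (0 : ℝ)).smul_const d).const_add x
  have h2 : HasFDerivAt f (fderiv ℝ f x) (x + (0 : ℝ) • d) := by simpa using h.hasFDerivAt
  exact h2.comp_hasDerivAt (0 : ℝ) h1

lemma continuousAt_line {F : Type*} [NormedAddCommGroup F] [NormedSpace ℝ F] (x d : F) :
    Tendsto (fun s : ℝ => x + s • d) (𝓝 0) (𝓝 x) := by
  have : ContinuousAt (fun s : ℝ => x + s • d) 0 := by fun_prop
  simpa [ContinuousAt] using this

lemma SmoothNear.halfHess_eq (h : SmoothNear ℓ z) (b c : E) :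
    halfHess (fun w => ℓ (z.1, w)) z.2 b c = vertHess ℓ z c b := by
  have h1 : ∀ᶠ s : ℝ in 𝓝 0, deriv (fun t : ℝ => ℓ (z.1, z.2 + t • b + s • c)) 0 =
      fderiv ℝ ℓ (z + s • (0, c)) (0, b) := by
    filter_upwards [(continuousAt_line z (0, c)).eventually h] with s hs
    have := (hasDerivAt_comp_line (ContDiffAt.differentiableAt_top hs) (0, b)).deriv
    rw [← this]
    congr 1
    ext t
    congr 1
    ext <;> simp [add_right_comm]
  have h2 : DifferentiableAt ℝ (fun z => fderiv ℝ ℓ z (0, b)) z :=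
    ((contDiffAt_fderiv_top h.contDiffAt).clm_apply contDiffAt_const).differentiableAt (by simp)
  rw [halfHess, EventuallyEq.deriv_eq h1, (hasDerivAt_comp_line h2 (0, c)).deriv, vertHess_apply,
    fderiv_clm_apply (ContDiffAt.differentiableAt_top (contDiffAt_fderiv_top h.contDiffAt))
      (differentiableAt_const _)]
  simp

variable [FiniteDimensional ℝ E]

lemma SmoothNear.contDiffAt_vertHess (h : SmoothNear ℓ z) : ContDiffAt ℝ ∞ (vertHess ℓ) z := by
  have := contDiffAt_fderiv_top (contDiffAt_fderiv_top h.contDiffAt)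
  refine contDiffAt_of_clm_apply fun b => contDiffAt_of_clm_apply fun c => ?_
  simp only [vertHess_apply]
  fun_prop

lemma SmoothNear.contDiffAt_horDeriv (h : SmoothNear ℓ z) : ContDiffAt ℝ ∞ (horDeriv ℓ) z :=
  (contDiffAt_fderiv_top h.contDiffAt_vertHess).clm_comp contDiffAt_const

lemma SmoothNear.contDiffAt_vertDeriv (h : SmoothNear ℓ z) : ContDiffAt ℝ ∞ (vertDeriv ℓ) z :=
  (contDiffAt_fderiv_top h.contDiffAt_vertHess).clm_comp contDiffAt_const

omit [FiniteDimensional ℝ E] in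
lemma fderiv_clm_apply₂ {F : Type*} [NormedAddCommGroup F] [NormedSpace ℝ F]
    {B : F → E →L[ℝ] E →L[ℝ] ℝ} {x : F} (hB : DifferentiableAt ℝ B x) (b c : E) (d : F) :
    fderiv ℝ (fun x => B x b c) x d = fderiv ℝ B x d b c := by
  have h1 : DifferentiableAt ℝ (fun x => B x b) x := hB.clm_apply (differentiableAt_const _)
  rw [fderiv_clm_apply h1 (differentiableAt_const _),
    fderiv_clm_apply hB (differentiableAt_const _)]
  simp

lemma SmoothNear.differentiableAt_vertHess (h : SmoothNear ℓ z) :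
    DifferentiableAt ℝ (vertHess ℓ) z := ContDiffAt.differentiableAt_top h.contDiffAt_vertHess

omit [FiniteDimensional ℝ E] in
lemma SmoothNear.vertHess_symm (h : SmoothNear ℓ z) (b c : E) :
    vertHess ℓ z b c = vertHess ℓ z c b := by
  rw [vertHess_apply, vertHess_apply, h.contDiffAt.isSymmSndFDerivAt (by simpa using two_le_infty)]

lemma SmoothNear.fderiv_vertHess_symm (h : SmoothNear ℓ z) (d : E × E) (b c : E) :
    fderiv ℝ (vertHess ℓ) z d b c = fderiv ℝ (vertHess ℓ) z d c b := by
  rw [← fderiv_clm_apply₂ h.differentiableAt_vertHess,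
    ← fderiv_clm_apply₂ h.differentiableAt_vertHess]
  have : (fun z => vertHess ℓ z b c) =ᶠ[𝓝 z] fun z => vertHess ℓ z c b := by
    filter_upwards [h.eventually] with z' hz'
    exact hz'.vertHess_symm b c
  rw [this.fderiv_eq]

lemma SmoothNear.vertDeriv_symm' (h : SmoothNear ℓ z) (a b c : E) :
    vertDeriv ℓ z a b c = vertDeriv ℓ z a c b := h.fderiv_vertHess_symm (0, a) b c

/-- With `c` fixed, `vertHess ℓ · b c` is half the derivative in direction `(0, b)` of `z ↦ fderiv ℝ
ℓ z (0, c)`; the claim is the symmetry of the second derivative of this function. -/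
lemma SmoothNear.vertDeriv_symm (h : SmoothNear ℓ z) (a b c : E) :
    vertDeriv ℓ z a b c = vertDeriv ℓ z b a c := by
  have hc : ContDiffAt ℝ ∞ (fun z => fderiv ℝ ℓ z (0, c)) z :=
    (contDiffAt_fderiv_top h.contDiffAt).clm_apply contDiffAt_const
  have key : ∀ b, (fun z => vertHess ℓ z b c) =ᶠ[𝓝 z]
      fun z => (1 / 2 : ℝ) * fderiv ℝ (fun z => fderiv ℝ ℓ z (0, c)) z (0, b) := fun b => by
    filter_upwards [h] with z' hz'
    rw [vertHess_apply, fderiv_clm_apply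
      (ContDiffAt.differentiableAt_top (contDiffAt_fderiv_top hz')) (differentiableAt_const _)]
    simp
  have key2 : ∀ a b, vertDeriv ℓ z a b c = (1 / 2 : ℝ) *
      fderiv ℝ (fderiv ℝ (fun z => fderiv ℝ ℓ z (0, c))) z (0, a) (0, b) := fun a b => by
    have hd := ContDiffAt.differentiableAt_top (contDiffAt_fderiv_top hc)
    rw [vertDeriv_apply, ← fderiv_clm_apply₂ h.differentiableAt_vertHess, (key b).fderiv_eq,
      fderiv_const_mul (hd.clm_apply (differentiableAt_const _)),
      fderiv_clm_apply hd (differentiableAt_const _)]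
    simp
  rw [key2, key2, hc.isSymmSndFDerivAt (by simpa using two_le_infty)]

lemma SmoothNear.quarterThird_eq (h : SmoothNear ℓ z) (a b c : E) :
    2 * quarterThird (fun w => ℓ (z.1, w)) z.2 a b c = vertDeriv ℓ z c b a := by
  -- The inner two derivatives are a Hessian without the factor `1 / 2`, whence the `2`.
  have h1 : ∀ᶠ s : ℝ in 𝓝 0, deriv (fun s₂ : ℝ => deriv (fun s₁ : ℝ =>
      ℓ (z.1, z.2 + s₁ • a + s₂ • b + s • c)) 0) 0 = 2 * vertHess ℓ (z + s • (0, c)) b a := by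
    filter_upwards [(continuousAt_line z (0, c)).eventually h.eventually] with s hs
    rw [← hs.halfHess_eq, halfHess]
    simp only [Prod.fst_add, Prod.snd_add, Prod.smul_fst, Prod.smul_snd, smul_zero, add_zero,
      add_right_comm _ (s • c)]
    ring
  have h2 := h.differentiableAt_vertHess
  have h3 : DifferentiableAt ℝ (fun z => vertHess ℓ z b a) z :=
    (h2.clm_apply (differentiableAt_const _)).clm_apply (differentiableAt_const _)
  rw [quarterThird, EventuallyEq.deriv_eq h1, ((hasDerivAt_comp_line h3 (0, c)).const_mul 2).deriv,
    vertDeriv_apply, fderiv_clm_apply₂ h2]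
  ring

/-- Positive homogeneity of degree two in the second variable, near `z`. -/
def HomogNear (ℓ : E × E → ℝ) (z : E × E) : Prop :=
  ∀ᶠ z' in 𝓝 z, ∀ r : ℝ, 0 < r → ℓ (z'.1, r • z'.2) = r ^ 2 * ℓ z'

omit [FiniteDimensional ℝ E] in
-- Euler's identity: differentiate homogeneity along `r = 1 + s` at `s = 0`.
lemma HomogNear.fderiv_eq (hh : HomogNear ℓ z) (h : SmoothNear ℓ z) :
    ∀ᶠ z' in 𝓝 z, fderiv ℝ ℓ z' (0, z'.2) = 2 * ℓ z' := by
  filter_upwards [hh, h] with z' hz' hs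
  have h1 : (fun s : ℝ => ℓ (z' + s • (0, z'.2))) =ᶠ[𝓝 0] fun s => (1 + s) ^ 2 * ℓ z' := by
    filter_upwards [lt_mem_nhds (show (-1 : ℝ) < 0 by norm_num)] with s hs
    rw [← hz' (1 + s) (by linarith)]
    congr 1
    ext <;> simp [add_smul]
  rw [← (hasDerivAt_comp_line (ContDiffAt.differentiableAt_top hs) (0, z'.2)).deriv, EventuallyEq.deriv_eq h1]
  have : HasDerivAt (fun s : ℝ => (1 + s) ^ 2 * ℓ z') (2 * (1 + 0) ^ 1 * 1 * ℓ z') 0 := by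
    simpa using ((((hasDerivAt_id (0 : ℝ)).const_add 1).pow 2).mul_const (ℓ z'))
  rw [this.deriv]
  ring

omit [FiniteDimensional ℝ E] in
-- Differentiate Euler's identity in the direction `(0, b)`.
lemma HomogNear.vertHess_eq (hh : HomogNear ℓ z) (h : SmoothNear ℓ z) (b : E) :
    ∀ᶠ z' in 𝓝 z, vertHess ℓ z' b z'.2 = (1 / 2 : ℝ) * fderiv ℝ ℓ z' (0, b) := by
  filter_upwards [(hh.fderiv_eq h).eventually_nhds, h] with z' hz' hs
  have hd := ContDiffAt.differentiableAt_top (contDiffAt_fderiv_top hs)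
  have hd0 := ContDiffAt.differentiableAt_top hs
  have h2 := congrArg (fun T => T (0, b)) (Filter.EventuallyEq.fderiv_eq (𝕜 := ℝ) hz')
  have h3 : HasFDerivAt (fun z : E × E => ((0 : E), z.2))
      ((0 : E × E →L[ℝ] E).prod (.snd ℝ E E)) z' :=
    (hasFDerivAt_const _ _).prodMk hasFDerivAt_snd
  rw [fderiv_clm_apply hd h3.differentiableAt, h3.fderiv, fderiv_const_mul hd0] at h2
  simp at h2
  rw [vertHess_apply]
  linarith

/-- Differentiate the identity `g(b, w) = ½ dℓ(0, b)` once more, in the direction `(0, c)`: the term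
`g(b, c)` appears on both sides, and the Cartan term that remains is zero. -/
lemma HomogNear.vertDeriv_self (hh : HomogNear ℓ z) (h : SmoothNear ℓ z) (b c : E) :
    vertDeriv ℓ z z.2 b c = 0 := by
  have h1 := hh.vertHess_eq h b
  have hd := ContDiffAt.differentiableAt_top (contDiffAt_fderiv_top h.contDiffAt)
  have hv := h.differentiableAt_vertHess
  have h2 := congrArg (fun T => T (0, c)) (Filter.EventuallyEq.fderiv_eq (𝕜 := ℝ) h1)
  rw [fderiv_clm_apply (hv.clm_apply (differentiableAt_const _)) differentiableAt_snd,
    fderiv_const_mul (hd.clm_apply (differentiableAt_const _)),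
    fderiv_clm_apply hd (differentiableAt_const _),
    fderiv_clm_apply hv (differentiableAt_const _)] at h2
  simp [fderiv_snd] at h2
  rw [h.vertDeriv_symm, vertDeriv_apply, h.fderiv_vertHess_symm, ← vertDeriv_apply,
    h.vertDeriv_symm, vertDeriv_apply]
  have h3 : vertHess ℓ z b c = 2⁻¹ * fderiv ℝ (fderiv ℝ ℓ) z (0, c) (0, b) := by
    rw [h.vertHess_symm, vertHess_apply]; norm_num
  linarith

/-- The coordinate expression of a regular vector. -/
structure LocallyRegular (ℓ : E × E → ℝ) (z : E × E) : Prop where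
  smooth : SmoothNear ℓ z
  homog : HomogNear ℓ z
  nondeg : ∀ a, (∀ b, vertHess ℓ z a b = 0) → a = 0

lemma LocallyRegular.chernData (h : LocallyRegular ℓ z) :
    ChernData (vertHess ℓ z) (horDeriv ℓ z) (vertDeriv ℓ z) z.2 where
  symm_G := h.smooth.vertHess_symm
  nondeg := h.nondeg
  symm_P a := h.smooth.fderiv_vertHess_symm (a, 0)
  symm_Q a := h.smooth.fderiv_vertHess_symm (0, a)
  symm_Q' := h.smooth.vertDeriv_symm
  Q_self := h.homog.vertDeriv_self h.smooth

/-- `Γ` is the Christoffel symbol of the Chern connection of `ℓ` with reference vector `z.2` at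
the point `z.1`. -/
def IsLocalChern (ℓ : E × E → ℝ) (z : E × E) (Γ : E →L[ℝ] E →L[ℝ] E) : Prop :=
  IsAlgChern (vertHess ℓ z) (horDeriv ℓ z) (vertDeriv ℓ z) z.2 Γ

/-- The Christoffel symbol of the Chern connection of `ℓ` with reference vector `z.2` at the
point `z.1`. -/
def localChern (ℓ : E × E → ℝ) (z : E × E) : E →L[ℝ] E →L[ℝ] E :=
  algChern (vertHess ℓ z) (horDeriv ℓ z) (vertDeriv ℓ z) z.2

lemma LocallyRegular.isLocalChern (h : LocallyRegular ℓ z) :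
    IsLocalChern ℓ z (localChern ℓ z) := h.chernData.isAlgChern_algChern

lemma LocallyRegular.contDiffAt_localChern (h : LocallyRegular ℓ z) :
    ContDiffAt ℝ ∞ (localChern ℓ) z :=
  contDiffAt_algChern h.smooth.contDiffAt_vertHess h.smooth.contDiffAt_horDeriv
    h.smooth.contDiffAt_vertDeriv contDiffAt_snd h.chernData

end LocalTheory

/-! ### Transformation of the tensors and of the Christoffel symbols under a change of coordinates.
-/

section CoordinateChange

variable {E : Type*} [NormedAddCommGroup E] [NormedSpace ℝ E]

/-- The second derivative of a composition of a map with a curve. -/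
lemma deriv_deriv_comp {φ : E → E} {y : ℝ → E} {s : ℝ} (hφ : ContDiffAt ℝ ∞ φ (y s))
    (hy : ContDiffAt ℝ ∞ y s) :
    deriv (deriv (fun v => φ (y v))) s =
      fderiv ℝ (fderiv ℝ φ) (y s) (deriv y s) (deriv y s) +
        fderiv ℝ φ (y s) (deriv (deriv y) s) := by
  have hy' : ContDiffAt ℝ ∞ (deriv y) s := by
    have := (contDiffAt_fderiv_top hy).clm_apply (contDiffAt_const (c := (1 : ℝ)))
    simpa using this
  have h1 : deriv (fun v => φ (y v)) =ᶠ[𝓝 s] fun v => fderiv ℝ φ (y v) (deriv y v) := by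
    have e1 : ∀ᶠ v in 𝓝 s, DifferentiableAt ℝ φ (y v) := hy.continuousAt.eventually
      ((hφ.of_le (m := 1) one_le_infty).eventually (by simp) |>.mono
        fun _ h => h.differentiableAt (by simp))
    have e2 : ∀ᶠ v in 𝓝 s, DifferentiableAt ℝ y v :=
      (hy.of_le (m := 1) one_le_infty).eventually (by simp) |>.mono
        fun _ h => h.differentiableAt (by simp)
    filter_upwards [e1, e2] with v h1 h2
    exact (h1.hasFDerivAt.comp_hasDerivAt v h2.hasDerivAt).deriv
  rw [EventuallyEq.deriv_eq h1]
  have h2 : HasDerivAt (fun v => fderiv ℝ φ (y v))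
      (fderiv ℝ (fderiv ℝ φ) (y s) (deriv y s)) s :=
    (ContDiffAt.differentiableAt_top (contDiffAt_fderiv_top hφ)).hasFDerivAt.comp_hasDerivAt s
      (ContDiffAt.differentiableAt_top hy).hasDerivAt
  exact (h2.clm_apply (ContDiffAt.differentiableAt_top hy').hasDerivAt).deriv

variable {ℓ ℓ' : E × E → ℝ} {φ : E → E} {z : E × E}

/-- The map of tangent bundles induced by `φ`. -/
def tangentLift (φ : E → E) (z : E × E) : E × E := (φ z.1, fderiv ℝ φ z.1 z.2)

lemma continuousAt_tangentLift (hφ : ContDiffAt ℝ ∞ φ z.1) :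
    ContinuousAt (tangentLift φ) z :=
  (hφ.continuousAt.comp continuousAt_fst).prodMk
    (((contDiffAt_fderiv_top hφ).continuousAt.comp continuousAt_fst).clm_apply continuousAt_snd)

/-- On a single fibre the induced map is linear, so the vertical Hessian is simply pulled back. -/
lemma vertHess_eq_of_coordChange (hℓ : SmoothNear ℓ z) (hℓ' : SmoothNear ℓ' (tangentLift φ z))
    (h : ∀ w, ℓ (z.1, w) = ℓ' (tangentLift φ (z.1, w))) (b c : E) :
    vertHess ℓ z b c =
      vertHess ℓ' (tangentLift φ z) (fderiv ℝ φ z.1 b) (fderiv ℝ φ z.1 c) := by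
  rw [← hℓ.halfHess_eq, ← hℓ'.halfHess_eq]
  simp only [halfHess, h, tangentLift, map_add, map_smul]

variable [FiniteDimensional ℝ E]

/-- Chain rule for the pullback formula. The second derivative of `φ` enters three times: through
the reference vector and through the two arguments `b` and `c`. -/
lemma fderiv_vertHess_of_coordChange (hℓ : SmoothNear ℓ z)
    (hℓ' : SmoothNear ℓ' (tangentLift φ z)) (hφ : ContDiffAt ℝ ∞ φ z.1)
    (h : ∀ᶠ y in 𝓝 z.1, ∀ w, ℓ (y, w) = ℓ' (tangentLift φ (y, w))) (d : E × E) (b c : E) :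
    fderiv ℝ (vertHess ℓ) z d b c =
      horDeriv ℓ' (tangentLift φ z) (fderiv ℝ φ z.1 d.1) (fderiv ℝ φ z.1 b) (fderiv ℝ φ z.1 c) +
      vertDeriv ℓ' (tangentLift φ z) (fderiv ℝ (fderiv ℝ φ) z.1 d.1 z.2 + fderiv ℝ φ z.1 d.2)
        (fderiv ℝ φ z.1 b) (fderiv ℝ φ z.1 c) +
      vertHess ℓ' (tangentLift φ z) (fderiv ℝ (fderiv ℝ φ) z.1 d.1 b) (fderiv ℝ φ z.1 c) +
      vertHess ℓ' (tangentLift φ z) (fderiv ℝ φ z.1 b) (fderiv ℝ (fderiv ℝ φ) z.1 d.1 c) := by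
  have h1 : (fun z => vertHess ℓ z b c) =ᶠ[𝓝 z] fun z =>
      vertHess ℓ' (tangentLift φ z) (fderiv ℝ φ z.1 b) (fderiv ℝ φ z.1 c) := by
    filter_upwards [hℓ.eventually, (continuousAt_tangentLift hφ).eventually hℓ'.eventually,
      continuousAt_fst.eventually h] with z' h1 h2 h3
    exact vertHess_eq_of_coordChange h1 h2 h3 b c
  have hv := hℓ.differentiableAt_vertHess
  have hline := continuousAt_line z d
  have h3 : DifferentiableAt ℝ (fun z => vertHess ℓ z b c) z :=
    (hv.clm_apply (differentiableAt_const _)).clm_apply (differentiableAt_const _)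
  rw [← fderiv_clm_apply₂ hv, ← (hasDerivAt_comp_line h3 d).deriv]
  refine (EventuallyEq.deriv_eq (h1.comp_tendsto hline)).trans ?_
  simp only [Function.comp_def]
  have hy : HasDerivAt (fun s : ℝ => (z + s • d).1) d.1 0 := by
    simpa using ((hasDerivAt_id (0 : ℝ)).smul_const d.1).const_add z.1
  have hw : HasDerivAt (fun s : ℝ => (z + s • d).2) d.2 0 := by
    simpa using ((hasDerivAt_id (0 : ℝ)).smul_const d.2).const_add z.2
  have hφ1 : HasFDerivAt φ (fderiv ℝ φ z.1) (z + (0 : ℝ) • d).1 := by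
    simpa using (ContDiffAt.differentiableAt_top hφ).hasFDerivAt
  have hφ2 : HasFDerivAt (fderiv ℝ φ) (fderiv ℝ (fderiv ℝ φ) z.1) (z + (0 : ℝ) • d).1 := by
    simpa using (ContDiffAt.differentiableAt_top (contDiffAt_fderiv_top hφ)).hasFDerivAt
  have k1 := hφ1.comp_hasDerivAt (0 : ℝ) hy
  have k2 := hφ2.comp_hasDerivAt (0 : ℝ) hy
  have k3 := k1.prodMk (k2.clm_apply hw)
  have k4 : HasFDerivAt (vertHess ℓ') (fderiv ℝ (vertHess ℓ') (tangentLift φ z))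
      (tangentLift φ (z + (0 : ℝ) • d)) := by
    simpa using hℓ'.differentiableAt_vertHess.hasFDerivAt
  have k5 := HasFDerivAt.comp_hasDerivAt (0 : ℝ)
    (f := fun s : ℝ => tangentLift φ (z + s • d)) k4 k3
  have k6 := (k5.clm_apply (k2.clm_apply (hasDerivAt_const (0 : ℝ) b))).clm_apply
    (k2.clm_apply (hasDerivAt_const (0 : ℝ) c))
  have k7 := k6.deriv
  simp only [Function.comp_def, map_zero, add_zero, zero_smul] at k7
  refine k7.trans ?_
  have hsplit : ∀ u v : E, fderiv ℝ (vertHess ℓ') (tangentLift φ z) (u, v) =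
      horDeriv ℓ' (tangentLift φ z) u + vertDeriv ℓ' (tangentLift φ z) v := fun u v => by
    rw [horDeriv, vertDeriv, ContinuousLinearMap.comp_apply, ContinuousLinearMap.comp_apply,
      ← map_add]
    simp
  rw [hsplit]
  simp only [add_apply]

/-- The transformation law of the Christoffel symbols of the Chern connection. -/
lemma IsLocalChern.coordChange {Γ : E →L[ℝ] E →L[ℝ] E} (hΓ : IsLocalChern ℓ z Γ)
    (hℓ : LocallyRegular ℓ z) (hℓ' : LocallyRegular ℓ' (tangentLift φ z))
    (hφ : ContDiffAt ℝ ∞ φ z.1)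
    (h : ∀ᶠ y in 𝓝 z.1, ∀ w, ℓ (y, w) = ℓ' (tangentLift φ (y, w)))
    (hinv : (fderiv ℝ φ z.1).IsInvertible) (a b : E) :
    fderiv ℝ φ z.1 (Γ a b) =
      localChern ℓ' (tangentLift φ z) (fderiv ℝ φ z.1 a) (fderiv ℝ φ z.1 b) +
        fderiv ℝ (fderiv ℝ φ) z.1 a b := by
  obtain ⟨e, he⟩ := hinv
  set T := fderiv ℝ φ z.1 with hT
  set Γ' := localChern ℓ' (tangentLift φ z) with hΓ'
  -- `Γ₁` is the symbol that the transformation law predicts. By uniqueness it is enough that `Γ₁`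
  -- satisfies the defining conditions for `ℓ`.
  let Γ₁ : E →L[ℝ] E →L[ℝ] E := (ContinuousLinearMap.compL ℝ E E E (e.symm : E →L[ℝ] E)).comp
    (Γ'.bilinearComp T T + fderiv ℝ (fderiv ℝ φ) z.1)
  have hΓ₁ : ∀ a b, T (Γ₁ a b) = Γ' (T a) (T b) + fderiv ℝ (fderiv ℝ φ) z.1 a b := fun a b => by
    have : Γ₁ a b = e.symm (Γ' (T a) (T b) + fderiv ℝ (fderiv ℝ φ) z.1 a b) := rfl
    rw [this, ← he]
    exact e.apply_symm_apply _
  have hc := hℓ'.isLocalChern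
  have hinj : Function.Injective T := by rw [← he]; exact e.injective
  have hz : (tangentLift φ z).2 = T z.2 := rfl
  have hG := vertHess_eq_of_coordChange hℓ.smooth hℓ'.smooth h.self_of_nhds
  suffices IsLocalChern ℓ z Γ₁ by
    rw [hℓ.chernData.isAlgChern_unique hΓ this, hΓ₁]
  refine ⟨fun a b => hinj ?_, fun a b c => ?_⟩
  · rw [hΓ₁, hΓ₁, hc.1, hφ.isSymmSndFDerivAt (by simpa using two_le_infty)]
  -- `e1` expands the horizontal derivative, `e2` the Cartan term. The three terms with the second
  -- derivative of `φ` in `e1` are matched by those in `Γ₁ a b`, `Γ₁ a c` and `Γ₁ a z.2`.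
  · have e1 := fderiv_vertHess_of_coordChange hℓ.smooth hℓ'.smooth hφ h (a, 0) b c
    have e2 := fderiv_vertHess_of_coordChange hℓ.smooth hℓ'.smooth hφ h (0, Γ₁ a z.2) b c
    rw [← horDeriv_apply] at e1
    rw [← vertDeriv_apply] at e2
    rw [e1, e2, hG, hG, ← hT, hΓ₁, hΓ₁, hΓ₁, hc.2, hz]
    simp only [map_zero, zero_apply, map_add, add_apply, add_zero, zero_add]
    ring

end CoordinateChange

/-! ### From the intrinsic definitions on `TM` to coordinates in an arbitrary chart. -/

section Charts

variable {E : Type*} [NormedAddCommGroup E] [NormedSpace ℝ E]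
  {M : Type*} [TopologicalSpace M] [ChartedSpace E M] [IsManifold 𝓘(ℝ, E) ∞ M]

/-- The components, in the preferred chart at `p`, of the tangent vectors at `q`. -/
def vecComp (p q : M) : E →L[ℝ] E := tangentCoordChange 𝓘(ℝ, E) q p q

variable (E) in
/-- The coordinate change from the preferred chart at `p` to the one at `q`. -/
def coordTrans (p q : M) (y : E) : E :=
  extChartAt 𝓘(ℝ, E) q ((extChartAt 𝓘(ℝ, E) p).symm y)

/-- A tangent vector as an element of the model space. -/
def fiberVec (v : TangentBundle 𝓘(ℝ, E) M) : E := v.snd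

lemma tangentChart_apply (p : M) (v : TangentBundle 𝓘(ℝ, E) M) :
    tangentChart p v = (extChartAt 𝓘(ℝ, E) p v.proj, vecComp p v.proj (fiberVec v)) := rfl

lemma mem_tangentChart_source {p : M} {v : TangentBundle 𝓘(ℝ, E) M} :
    v ∈ (tangentChart p).source ↔ v.proj ∈ (extChartAt 𝓘(ℝ, E) p).source := by
  simp [tangentChart, extChartAt]

lemma mem_tangentChart_target {p : M} {z : E × E} :
    z ∈ (tangentChart (E := E) p).target ↔ z.1 ∈ (extChartAt 𝓘(ℝ, E) p).target := by
  rw [tangentChart]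
  erw [FiberBundle.extChartAt_target]
  simp only [TangentBundle.trivializationAt_baseSet, mem_prod, mem_univ, and_true, mem_inter_iff,
    and_iff_left_iff_imp, mem_preimage]
  intro h
  rw [← extChartAt_source 𝓘(ℝ, E)]
  exact (extChartAt 𝓘(ℝ, E) p).map_target h

lemma tangentChart_symm_proj {p : M} {z : E × E} (hz : z.1 ∈ (extChartAt 𝓘(ℝ, E) p).target) :
    ((tangentChart p).symm z).proj = (extChartAt 𝓘(ℝ, E) p).symm z.1 := by
  have h1 := mem_tangentChart_target.2 hz
  have h2 := (tangentChart p).right_inv h1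
  have h3 := mem_tangentChart_source.1 ((tangentChart p).map_target h1)
  rw [tangentChart_apply] at h2
  rw [← h2, (extChartAt 𝓘(ℝ, E) p).left_inv h3, h2]

lemma vecComp_self (p : M) (w : E) : vecComp p p w = w :=
  tangentCoordChange_self (mem_extChartAt_source p)

lemma tangentChart_self (v : TangentBundle 𝓘(ℝ, E) M) :
    tangentChart v.proj v = (extChartAt 𝓘(ℝ, E) v.proj v.proj, fiberVec v) := by
  rw [tangentChart_apply, vecComp_self]

lemma fderiv_coordTrans {p q r : M} :
    fderiv ℝ (coordTrans E p q) (extChartAt 𝓘(ℝ, E) p r) = tangentCoordChange 𝓘(ℝ, E) p q r := by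
  rw [tangentCoordChange_def, modelWithCornersSelf_coe, range_id, fderivWithin_univ]
  rfl

lemma fderiv_coordTrans_self {p q : M} :
    fderiv ℝ (coordTrans E q p) (extChartAt 𝓘(ℝ, E) q q) = vecComp p q :=
  fderiv_coordTrans

lemma vecComp_eq {p q r : M} (hp : r ∈ (extChartAt 𝓘(ℝ, E) p).source)
    (hq : r ∈ (extChartAt 𝓘(ℝ, E) q).source) (w : E) :
    vecComp q r w = fderiv ℝ (coordTrans E p q) (extChartAt 𝓘(ℝ, E) p r) (vecComp p r w) := by
  rw [fderiv_coordTrans]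
  exact (tangentCoordChange_comp ⟨⟨mem_extChartAt_source r, hp⟩, hq⟩).symm

lemma contDiffAt_coordTrans {p q r : M} (hp : r ∈ (extChartAt 𝓘(ℝ, E) p).source)
    (hq : r ∈ (extChartAt 𝓘(ℝ, E) q).source) :
    ContDiffAt ℝ ∞ (coordTrans E p q) (extChartAt 𝓘(ℝ, E) p r) := by
  have h' : extChartAt 𝓘(ℝ, E) p r ∈
      ((extChartAt 𝓘(ℝ, E) p).symm ≫ (extChartAt 𝓘(ℝ, E) q)).source := by
    rw [PartialEquiv.trans_source'', PartialEquiv.symm_symm, PartialEquiv.symm_target]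
    exact mem_image_of_mem _ ⟨hp, hq⟩
  have := contDiffWithinAt_ext_coord_change (n := ∞) q p h'
  rwa [modelWithCornersSelf_coe, range_id, contDiffWithinAt_univ] at this

lemma vecComp_isInvertible {p q : M} (h : q ∈ (extChartAt 𝓘(ℝ, E) p).source) :
    (vecComp p q : E →L[ℝ] E).IsInvertible := by
  refine ⟨ContinuousLinearEquiv.equivOfInverse (vecComp p q) (tangentCoordChange 𝓘(ℝ, E) p q q)
    (fun w => ?_) (fun w => ?_), rfl⟩
  · rw [vecComp, tangentCoordChange_comp ⟨⟨mem_extChartAt_source q, h⟩, mem_extChartAt_source q⟩]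
    exact tangentCoordChange_self (mem_extChartAt_source q)
  · rw [vecComp, tangentCoordChange_comp ⟨⟨h, mem_extChartAt_source q⟩, h⟩]
    exact tangentCoordChange_self h

lemma tangentLift_tangentChart {p q : M} {v : TangentBundle 𝓘(ℝ, E) M}
    (hp : v.proj ∈ (extChartAt 𝓘(ℝ, E) p).source) (hq : v.proj ∈ (extChartAt 𝓘(ℝ, E) q).source) :
    tangentLift (coordTrans E p q) (tangentChart p v) = tangentChart q v := by
  rw [tangentChart_apply, tangentChart_apply, vecComp_eq hp hq]
  refine Prod.ext ?_ rfl
  simp only [tangentLift, coordTrans, (extChartAt 𝓘(ℝ, E) p).left_inv hp]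

/-- `localL` as a function on `E × E`. -/
def chartL (L : TangentBundle 𝓘(ℝ, E) M → ℝ) (p : M) (z : E × E) : ℝ :=
  L ((tangentChart p).symm z)

variable {L : TangentBundle 𝓘(ℝ, E) M → ℝ}

lemma chartL_tangentChart {p : M} {v : TangentBundle 𝓘(ℝ, E) M}
    (h : v.proj ∈ (extChartAt 𝓘(ℝ, E) p).source) : chartL L p (tangentChart p v) = L v := by
  rw [chartL, (tangentChart p).left_inv (mem_tangentChart_source.2 h)]

omit [IsManifold 𝓘(ℝ, E) ∞ M] in
lemma eventually_mem_source_of_chart {p q r : M} (hp : r ∈ (extChartAt 𝓘(ℝ, E) p).source)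
    (hq : r ∈ (extChartAt 𝓘(ℝ, E) q).source) :
    ∀ᶠ y in 𝓝 (extChartAt 𝓘(ℝ, E) p r), y ∈ (extChartAt 𝓘(ℝ, E) p).target ∧
      (extChartAt 𝓘(ℝ, E) p).symm y ∈ (extChartAt 𝓘(ℝ, E) q).source := by
  refine Filter.Eventually.and ((isOpen_extChartAt_target p).mem_nhds
    ((extChartAt 𝓘(ℝ, E) p).map_source hp)) ?_
  refine (continuousAt_extChartAt_symm' hp).eventually ((isOpen_extChartAt_source q).mem_nhds ?_)
  rwa [(extChartAt 𝓘(ℝ, E) p).left_inv hp]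

lemma chartL_coordTrans {p q r : M} (hp : r ∈ (extChartAt 𝓘(ℝ, E) p).source)
    (hq : r ∈ (extChartAt 𝓘(ℝ, E) q).source) :
    ∀ᶠ y in 𝓝 (extChartAt 𝓘(ℝ, E) p r), ∀ w,
      chartL L p (y, w) = chartL L q (tangentLift (coordTrans E p q) (y, w)) := by
  filter_upwards [eventually_mem_source_of_chart hp hq] with y hy w
  have h1 := mem_tangentChart_target (z := (y, w)).2 hy.1
  have h2 := (tangentChart p).right_inv h1
  have h3 := mem_tangentChart_source.1 ((tangentChart p).map_target h1)
  rw [← h2, tangentLift_tangentChart h3, chartL_tangentChart h3, chartL_tangentChart]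
  all_goals
    rw [tangentChart_symm_proj (z := (y, w)) hy.1]
    exact hy.2

lemma continuousAt_tangentChart_symm {p : M} {v : TangentBundle 𝓘(ℝ, E) M}
    (h : v.proj ∈ (extChartAt 𝓘(ℝ, E) p).source) :
    Tendsto (tangentChart p).symm (𝓝 (tangentChart p v)) (𝓝 v) := by
  have := continuousAt_extChartAt_symm' (I := 𝓘(ℝ, E).tangent) (mem_tangentChart_source.2 h)
  rw [ContinuousAt, ← tangentChart, (tangentChart p).left_inv (mem_tangentChart_source.2 h)] at this
  exact this

lemma continuousAt_tangentChart {p : M} {v : TangentBundle 𝓘(ℝ, E) M}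
    (h : v.proj ∈ (extChartAt 𝓘(ℝ, E) p).source) : ContinuousAt (tangentChart p) v :=
  continuousAt_extChartAt' (I := 𝓘(ℝ, E).tangent) (mem_tangentChart_source.2 h)

lemma eventually_mem_tangentChart_target {p : M} {v : TangentBundle 𝓘(ℝ, E) M}
    (h : v.proj ∈ (extChartAt 𝓘(ℝ, E) p).source) :
    ∀ᶠ z in 𝓝 (tangentChart p v), z ∈ (tangentChart p).target :=
  extChartAt_target_mem_nhds' (I := 𝓘(ℝ, E).tangent)
    ((tangentChart p).map_source (mem_tangentChart_source.2 h))

lemma smoothNear_chartL {p : M} {v : TangentBundle 𝓘(ℝ, E) M}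
    (hL : ∀ᶠ w in 𝓝 v, ContMDiffAt 𝓘(ℝ, E).tangent 𝓘(ℝ, ℝ) ∞ L w)
    (h : v.proj ∈ (extChartAt 𝓘(ℝ, E) p).source) :
    SmoothNear (chartL L p) (tangentChart p v) := by
  filter_upwards [(continuousAt_tangentChart_symm h).eventually hL,
    (eventually_mem_tangentChart_target h).eventually_nhds] with z hz hz'
  have h1 : ContMDiffAt 𝓘(ℝ, E × E) 𝓘(ℝ, E).tangent ∞ (tangentChart (E := E) p).symm z :=
    (contMDiffOn_extChartAt_symm (I := 𝓘(ℝ, E).tangent) (n := ∞)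
      (⟨p, 0⟩ : TangentBundle 𝓘(ℝ, E) M)).contMDiffAt hz'
  exact contMDiffAt_iff_contDiffAt.1 (hz.comp z h1)

omit [IsManifold 𝓘(ℝ, E) ∞ M] in
lemma halfHess_comp_linear {F : Type*} [AddCommGroup F] [Module ℝ F] (f : E → ℝ) (T : F →ₗ[ℝ] E)
    (v u w : F) : halfHess (fun z => f (T z)) v u w = halfHess f (T v) (T u) (T w) := by
  simp only [halfHess, map_add, map_smul]

/-- Passing to components is linear on the fibre, so `halfHess_comp_linear` applies. -/
lemma fundTensor_eq {p : M} {v : TangentBundle 𝓘(ℝ, E) M}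
    (hL : ∀ᶠ w in 𝓝 v, ContMDiffAt 𝓘(ℝ, E).tangent 𝓘(ℝ, ℝ) ∞ L w)
    (h : v.proj ∈ (extChartAt 𝓘(ℝ, E) p).source) (u w : E) :
    fundTensor L v u w = vertHess (chartL L p) (tangentChart p v)
      (vecComp p v.proj u) (vecComp p v.proj w) := by
  have hs := smoothNear_chartL hL h
  rw [hs.vertHess_symm, ← hs.halfHess_eq]
  let T : E →L[ℝ] E := vecComp p v.proj
  have : (fun z : TangentSpace 𝓘(ℝ, E) v.proj => L ⟨v.proj, z⟩) = fun z : E =>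
      chartL L p ((tangentChart p v).1, (T : E →ₗ[ℝ] E) z) := by
    ext z
    exact (chartL_tangentChart (v := ⟨v.proj, z⟩) h).symm
  refine Eq.trans (b := halfHess (fun z : E =>
    chartL L p ((tangentChart p v).1, (T : E →ₗ[ℝ] E) z)) (fiberVec v) u w) ?_ ?_
  · rw [← this]
    rfl
  exact halfHess_comp_linear (fun x => chartL L p ((tangentChart p v).1, x))
    (T : E →ₗ[ℝ] E) (fiberVec v) u w

lemma IsRegularAt.nondeg {p : M} {v : TangentBundle 𝓘(ℝ, E) M} (hv : IsRegularAt L v)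
    (h : v.proj ∈ (extChartAt 𝓘(ℝ, E) p).source) (a : E)
    (ha : ∀ b, vertHess (chartL L p) (tangentChart p v) a b = 0) : a = 0 := by
  obtain ⟨e, he⟩ := vecComp_isInvertible h
  have h1 : e.symm a = 0 := hv.2 (e.symm a) fun w => by
    refine (fundTensor_eq hv.1 h (e.symm a) w).trans ?_
    rw [← he]
    simp [ha]
  simpa using h1

lemma isRegularAt_of_nondeg {p : M} {v : TangentBundle 𝓘(ℝ, E) M}
    (hL : ∀ᶠ w in 𝓝 v, ContMDiffAt 𝓘(ℝ, E).tangent 𝓘(ℝ, ℝ) ∞ L w)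
    (h : v.proj ∈ (extChartAt 𝓘(ℝ, E) p).source)
    (hn : ∀ a, (∀ b, vertHess (chartL L p) (tangentChart p v) a b = 0) → a = 0) :
    IsRegularAt L v := by
  refine ⟨hL, fun u hu => ?_⟩
  obtain ⟨e, he⟩ := vecComp_isInvertible h
  have h1 : e u = 0 := hn (e u) fun b => by
    have := (fundTensor_eq hL h u (e.symm b)).symm.trans (hu (e.symm b))
    rw [← he] at this
    simpa using this
  exact (map_eq_zero_iff e e.injective).1 h1

variable [FiniteDimensional ℝ E]

omit [IsManifold 𝓘(ℝ, E) ∞ M] in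
lemma isInvertible_iff_nondeg (G : E →L[ℝ] E →L[ℝ] ℝ) :
    G.IsInvertible ↔ ∀ a, (∀ b, G a b = 0) → a = 0 := by
  constructor
  · rintro ⟨e, rfl⟩ a ha
    have : e a = 0 := by ext b; exact ha b
    simpa using this
  · intro h
    have hdim : Module.finrank ℝ E = Module.finrank ℝ (E →L[ℝ] ℝ) := by
      rw [← LinearEquiv.finrank_eq (LinearMap.toContinuousLinearMap (E := E) (F' := ℝ) (𝕜 := ℝ))]
      exact Subspace.dual_finrank_eq.symm
    have hinj : Function.Injective (G : E →ₗ[ℝ] (E →L[ℝ] ℝ)) := by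
      rw [injective_iff_map_eq_zero]
      intro a ha
      refine h a fun b => ?_
      have : G a = 0 := ha
      rw [this]; rfl
    exact ⟨(LinearEquiv.ofInjectiveOfFinrankEq _ hinj hdim).toContinuousLinearEquiv, by ext; rfl⟩

/-- In a fixed chart nondegeneracy means that the Hessian, as a map to the dual, is invertible; it
depends continuously on the vector, and the invertible maps form an open set. -/
lemma IsRegularAt.eventually {v : TangentBundle 𝓘(ℝ, E) M} (hv : IsRegularAt L v) :
    ∀ᶠ v' in 𝓝 v, IsRegularAt L v' := by
  have hp : v.proj ∈ (extChartAt 𝓘(ℝ, E) v.proj).source := mem_extChartAt_source _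
  have h1 := (isInvertible_iff_nondeg _).2 (hv.nondeg hp)
  obtain ⟨e, he⟩ := h1
  have h2 : ∀ᶠ G in 𝓝 (vertHess (chartL L v.proj) (tangentChart v.proj v)), G.IsInvertible := by
    rw [← he]
    exact ContinuousLinearEquiv.nhds e
  have h3 : Tendsto (fun v' => vertHess (chartL L v.proj) (tangentChart v.proj v')) (𝓝 v)
      (𝓝 (vertHess (chartL L v.proj) (tangentChart v.proj v))) :=
    (smoothNear_chartL hv.1 hp).contDiffAt_vertHess.continuousAt.tendsto.comp
      (continuousAt_tangentChart hp)
  have h4 : ∀ᶠ v' : TangentBundle 𝓘(ℝ, E) M in 𝓝 v,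
      v'.proj ∈ (extChartAt 𝓘(ℝ, E) v.proj).source :=
    (FiberBundle.continuous_proj E (TangentSpace 𝓘(ℝ, E))).continuousAt.eventually
      ((isOpen_extChartAt_source v.proj).mem_nhds hp)
  filter_upwards [hv.1.eventually_nhds, h3.eventually h2, h4] with v' h1 h2 h4
  exact isRegularAt_of_nondeg h1 h4 ((isInvertible_iff_nondeg _).1 h2)

omit [FiniteDimensional ℝ E] in
lemma homogNear_chartL (F : FinslerSpacetime E M) {p : M} {v : TangentBundle 𝓘(ℝ, E) M}
    (hv : v ∈ F.Astar) (h : v.proj ∈ (extChartAt 𝓘(ℝ, E) p).source) :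
    HomogNear (chartL F.L p) (tangentChart p v) := by
  filter_upwards [(continuousAt_tangentChart_symm h).eventually (F.isOpen_Astar.mem_nhds hv),
    eventually_mem_tangentChart_target h] with z hz hz' r hr
  have h3 := mem_tangentChart_source.1 ((tangentChart p).map_target hz')
  have h4 := F.homogeneous_L _ hz r hr
  rw [← chartL_tangentChart (L := F.L) (p := p) (by exact h3)] at h4
  refine Eq.trans ?_ h4
  congr 1
  have h5 := (tangentChart p).right_inv hz'
  rw [tangentChart_apply] at h5 ⊢
  refine Prod.ext (congrArg Prod.fst h5).symm ?_
  exact ((map_smul (vecComp p _) r _).trans (congrArg (r • ·) (congrArg Prod.snd h5))).symm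

omit [FiniteDimensional ℝ E] in
lemma locallyRegular_chartL (F : FinslerSpacetime E M) {p : M} {v : TangentBundle 𝓘(ℝ, E) M}
    (hv : v ∈ F.Astar) (hr : IsRegularAt F.L v) (h : v.proj ∈ (extChartAt 𝓘(ℝ, E) p).source) :
    LocallyRegular (chartL F.L p) (tangentChart p v) :=
  ⟨smoothNear_chartL hr.1 h, homogNear_chartL F hv h, hr.nondeg h⟩

omit [IsManifold 𝓘(ℝ, E) ∞ M] in
lemma isLocalChern_iff {ℓ : E × E → ℝ} {y w : E} (hs : SmoothNear ℓ (y, w))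
    (Γ : E →L[ℝ] E →L[ℝ] E) :
    IsLocalChern ℓ (y, w) Γ ↔ (∀ a b, Γ a b = Γ b a) ∧
      ∀ a b c, deriv (fun s : ℝ => halfHess (fun x => ℓ (y + s • a, x)) w b c) 0 =
        halfHess (fun x => ℓ (y, x)) w (Γ a b) c + halfHess (fun x => ℓ (y, x)) w b (Γ a c) +
          2 * quarterThird (fun x => ℓ (y, x)) w (Γ a w) b c := by
  rw [IsLocalChern, IsAlgChern]
  refine and_congr Iff.rfl (forall_congr' fun a => forall_congr' fun b => forall_congr' fun c => ?_)
  have h0 : ∀ b c, halfHess (fun x => ℓ (y, x)) w b c = vertHess ℓ (y, w) b c := fun b c => by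
    rw [hs.vertHess_symm]
    exact hs.halfHess_eq b c
  have h1 : (fun s : ℝ => halfHess (fun x => ℓ (y + s • a, x)) w b c) =ᶠ[𝓝 0]
      fun s => vertHess ℓ ((y, w) + s • (a, 0)) b c := by
    filter_upwards [(continuousAt_line _ (a, 0)).eventually hs.eventually] with s hs'
    rw [hs'.vertHess_symm, ← hs'.halfHess_eq]
    simp
  have hv := hs.differentiableAt_vertHess
  have h3 : DifferentiableAt ℝ (fun z => vertHess ℓ z b c) (y, w) :=
    (hv.clm_apply (differentiableAt_const _)).clm_apply (differentiableAt_const _)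
  -- `quarterThird_eq` lists the directions in reverse order; total symmetry restores it.
  have h4 : 2 * quarterThird (fun x => ℓ (y, x)) w (Γ a w) b c =
      vertDeriv ℓ (y, w) (Γ a w) b c := by
    refine (hs.quarterThird_eq (Γ a w) b c).trans ?_
    rw [hs.vertDeriv_symm' c b, hs.vertDeriv_symm c, hs.vertDeriv_symm' _ c b]
  rw [EventuallyEq.deriv_eq h1, (hasDerivAt_comp_line h3 (a, 0)).deriv, fderiv_clm_apply₂ hv, h0,
    h0, h4, horDeriv_apply]

lemma isChernSymbol_iff {v : TangentBundle 𝓘(ℝ, E) M}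
    (hr : IsRegularAt L v) (Γ : E →L[ℝ] E →L[ℝ] E) :
    IsChernSymbol L v Γ ↔ IsLocalChern (chartL L v.proj) (tangentChart v.proj v) Γ := by
  have hs := smoothNear_chartL hr.1 (mem_extChartAt_source (I := 𝓘(ℝ, E)) v.proj)
  rw [tangentChart_self] at hs ⊢
  exact (isLocalChern_iff hs Γ).symm

lemma chernSymbol_isLocalChern (F : FinslerSpacetime E M) {v : TangentBundle 𝓘(ℝ, E) M}
    (hv : v ∈ F.Astar) (hr : IsRegularAt F.L v) :
    IsLocalChern (chartL F.L v.proj) (tangentChart v.proj v) (chernSymbol F.L v) := by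
  have h : ∃ Γ, IsChernSymbol F.L v Γ := ⟨_, (isChernSymbol_iff hr _).2
    (locallyRegular_chartL F hv hr (mem_extChartAt_source v.proj)).isLocalChern⟩
  rw [← isChernSymbol_iff hr, chernSymbol, dif_pos h]
  exact h.choose_spec

/-- The Christoffel symbols of the Chern connection at `v`, which are taken in the preferred chart
at the base point of `v`, in terms of the ones in another chart. -/
lemma vecComp_chernSymbol (F : FinslerSpacetime E M) {p : M} {v : TangentBundle 𝓘(ℝ, E) M}
    (hv : v ∈ F.Astar) (hr : IsRegularAt F.L v) (h : v.proj ∈ (extChartAt 𝓘(ℝ, E) p).source)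
    (a b : E) :
    vecComp p v.proj (chernSymbol F.L v a b) =
      localChern (chartL F.L p) (tangentChart p v) (vecComp p v.proj a) (vecComp p v.proj b) +
      fderiv ℝ (fderiv ℝ (coordTrans E v.proj p)) (extChartAt 𝓘(ℝ, E) v.proj v.proj) a b := by
  have hs : v.proj ∈ (extChartAt 𝓘(ℝ, E) v.proj).source := mem_extChartAt_source v.proj
  have hl := tangentLift_tangentChart hs h
  have := (chernSymbol_isLocalChern F hv hr).coordChange (φ := coordTrans E v.proj p)
    (ℓ' := chartL F.L p) (locallyRegular_chartL F hv hr hs)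
    (by rw [hl]; exact locallyRegular_chartL F hv hr h) (contDiffAt_coordTrans hs h)
    (chartL_coordTrans hs h)
    (by rw [tangentChart_apply, fderiv_coordTrans_self]; exact vecComp_isInvertible h) a b
  rw [hl] at this
  rw [← fderiv_coordTrans_self]
  exact this

end Charts

/-! ### How a perturbation in one chart changes derivatives in another. -/

section Perturbation

variable {E : Type*} [NormedAddCommGroup E] [NormedSpace ℝ E]

lemma exists_Ioo_of_eventually {P : ℝ → Prop} (h : ∀ᶠ v in 𝓝 (0 : ℝ), P v) :
    ∃ ε > 0, ∀ v ∈ Ioo (-ε) ε, P v := by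
  obtain ⟨ε, hε, h⟩ := Metric.eventually_nhds_iff_ball.1 h
  refine ⟨ε, hε, fun v hv => h v ?_⟩
  rwa [Real.ball_eq_Ioo, zero_sub, zero_add]

lemma contDiffAt_deriv_top {F : Type*} [NormedAddCommGroup F] [NormedSpace ℝ F] {y : ℝ → F}
    {s : ℝ} (hy : ContDiffAt ℝ ∞ y s) : ContDiffAt ℝ ∞ (deriv y) s := by
  have := (contDiffAt_fderiv_top hy).clm_apply (contDiffAt_const (c := (1 : ℝ)))
  simpa using this

lemma eventually_differentiableAt {F : Type*} [NormedAddCommGroup F] [NormedSpace ℝ F] {y : ℝ → F}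
    {s : ℝ} (hy : ContDiffAt ℝ ∞ y s) : ∀ᶠ v in 𝓝 s, DifferentiableAt ℝ y v :=
  ((hy.of_le one_le_infty).eventually (by simp)).mono fun _ h => h.differentiableAt (by simp)

lemma deriv_comp_perturbation {φ : E → E} {c : ℝ → E} {f : ℝ → ℝ} (hφ : ContDiffAt ℝ ∞ φ (c 0))
    (hc : ContDiffAt ℝ ∞ c 0) (hf : ContDiff ℝ ∞ f) (hf0 : f 0 = 0) (r : ℝ) (w : E) :
    deriv (fun v => φ (c v + (r * f v) • w)) 0 =
      deriv (fun v => φ (c v)) 0 + (r * deriv f 0) • fderiv ℝ φ (c 0) w := by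
  have h1 : HasFDerivAt φ (fderiv ℝ φ (c 0)) (c 0) :=
    (ContDiffAt.differentiableAt_top hφ).hasFDerivAt
  have h1' : HasFDerivAt φ (fderiv ℝ φ (c 0)) (c 0 + (r * f 0) • w) := by simpa [hf0] using h1
  have h2 := (ContDiffAt.differentiableAt_top hc).hasDerivAt
  have h3 := ((ContDiffAt.differentiableAt_top hf.contDiffAt (x := (0 : ℝ))).hasDerivAt.const_mul
    r).smul_const w
  refine (h1'.comp_hasDerivAt (0 : ℝ) (h2.add h3)).deriv.trans ?_
  rw [map_add, map_smul, ← (h1.comp_hasDerivAt (0 : ℝ) h2).deriv]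
  rfl

/-- As `f' 0 = 0`, both curves have the same velocity at `0`, so the term with the second derivative
of `φ` is the same for both. Hence the second-order change transforms as a vector. -/
lemma deriv_deriv_comp_perturbation {φ : E → E} {c : ℝ → E} {f : ℝ → ℝ}
    (hφ : ContDiffAt ℝ ∞ φ (c 0)) (hc : ContDiffAt ℝ ∞ c 0) (hf : ContDiff ℝ ∞ f) (hf0 : f 0 = 0)
    (hf1 : deriv f 0 = 0) (r : ℝ) (w : E) :
    deriv (deriv (fun v => φ (c v + (r * f v) • w))) 0 =
      deriv (deriv (fun v => φ (c v))) 0 + (r * deriv (deriv f) 0) • fderiv ℝ φ (c 0) w := by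
  have hc' : ContDiffAt ℝ ∞ (fun v => c v + (r * f v) • w) 0 :=
    hc.add ((contDiffAt_const.mul hf.contDiffAt).smul contDiffAt_const)
  have h0 : c 0 + (r * f 0) • w = c 0 := by simp [hf0]
  have h1 : deriv (fun v => c v + (r * f v) • w) =ᶠ[𝓝 0]
      fun v => deriv c v + (r * deriv f v) • w := by
    filter_upwards [eventually_differentiableAt hc] with v hv
    have h3 := ((ContDiffAt.differentiableAt_top hf.contDiffAt (x := v)).hasDerivAt.const_mul
      r).smul_const w
    exact (hv.hasDerivAt.add h3).deriv
  have h2 : deriv (deriv fun v => c v + (r * f v) • w) 0 =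
      deriv (deriv c) 0 + (r * deriv (deriv f) 0) • w := by
    rw [EventuallyEq.deriv_eq h1]
    have h3 := (ContDiffAt.differentiableAt_top
      (contDiffAt_deriv_top (hf.contDiffAt (x := (0 : ℝ))))).hasDerivAt
    exact ((ContDiffAt.differentiableAt_top (contDiffAt_deriv_top hc)).hasDerivAt.add
      ((h3.const_mul r).smul_const w)).deriv
  have h3 := h1.self_of_nhds
  simp only [hf1, mul_zero, zero_smul, add_zero] at h3
  rw [deriv_deriv_comp (φ := φ) (y := fun v => c v + (r * f v) • w) (by rwa [h0]) hc',
    deriv_deriv_comp hφ hc, h0, h2, h3, map_add, map_smul, add_assoc]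

end Perturbation

/-! ### Curves and variations in charts; displacement inside one chart. -/

section Curves

variable {E : Type*} [NormedAddCommGroup E] [NormedSpace ℝ E]
  {M : Type*} [TopologicalSpace M] [ChartedSpace E M] [IsManifold 𝓘(ℝ, E) ∞ M]

lemma contDiffWithinAt_chart {F : Type*} [NormedAddCommGroup F] [NormedSpace ℝ F] {x : F → M}
    {s : Set F} {z : F} {p : M} (hx : ContMDiffWithinAt 𝓘(ℝ, F) 𝓘(ℝ, E) ∞ x s z)
    (hp : x z ∈ (extChartAt 𝓘(ℝ, E) p).source) :
    ContDiffWithinAt ℝ ∞ (fun z => extChartAt 𝓘(ℝ, E) p (x z)) s z :=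
  contMDiffWithinAt_iff_contDiffWithinAt.1 <|
    (contMDiffAt_extChartAt' (I := 𝓘(ℝ, E)) (n := ∞)
      (by rwa [extChartAt_source] at hp)).comp_contMDiffWithinAt z hx

lemma contDiffWithinAt_vecComp {σ : ℝ → M} {V : (u : ℝ) → TangentSpace 𝓘(ℝ, E) (σ u)} {s : Set ℝ}
    {u : ℝ} {p : M} (hV : ContMDiffWithinAt 𝓘(ℝ, ℝ) 𝓘(ℝ, E).tangent ∞
      (fun u => (⟨σ u, V u⟩ : TangentBundle 𝓘(ℝ, E) M)) s u)
    (hp : σ u ∈ (extChartAt 𝓘(ℝ, E) p).source) :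
    ContDiffWithinAt ℝ ∞ (fun u => vecComp p (σ u) (V u)) s u := by
  have h1 : ContMDiffAt 𝓘(ℝ, E).tangent 𝓘(ℝ, E × E) ∞ (tangentChart (E := E) p)
      (⟨σ u, V u⟩ : TangentBundle 𝓘(ℝ, E) M) :=
    contMDiffAt_extChartAt' (I := 𝓘(ℝ, E).tangent) (n := ∞)
      (by rw [← extChartAt_source 𝓘(ℝ, E).tangent]; exact mem_tangentChart_source.2 hp)
  have h2 := contMDiffWithinAt_iff_contDiffWithinAt.1 (h1.comp_contMDiffWithinAt u hV)
  exact h2.snd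

/-- The components of the velocity of a curve. -/
lemma vecComp_velocity {γ : ℝ → M} {s : Set ℝ} {u : ℝ} {p : M}
    (hγ : ContMDiffWithinAt 𝓘(ℝ, ℝ) 𝓘(ℝ, E) ∞ γ s u) (hs : UniqueDiffWithinAt ℝ s u)
    (hp : γ u ∈ (extChartAt 𝓘(ℝ, E) p).source) :
    (vecComp p (γ u) : E →L[ℝ] E) (velocity γ s u) =
      derivWithin (fun u => extChartAt 𝓘(ℝ, E) p (γ u)) s u := by
  have hmd : MDifferentiableWithinAt 𝓘(ℝ, ℝ) 𝓘(ℝ, E) γ s u := hγ.mdifferentiableWithinAt (by simp)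
  have hself := mem_extChartAt_source (I := 𝓘(ℝ, E)) (γ u)
  let T : ℝ →L[ℝ] E := mfderivWithin 𝓘(ℝ, ℝ) 𝓘(ℝ, E) γ s u
  -- The manifold derivative is by definition the derivative in the preferred chart at `γ u`; the
  -- coordinate change to `p` does the rest.
  have h1 : HasFDerivWithinAt (fun t => extChartAt 𝓘(ℝ, E) (γ u) (γ t)) T s u :=
    HasFDerivWithinAt.mono hmd.hasMFDerivWithinAt.2 fun t ht => ⟨ht, mem_range_self t⟩
  have h2 := h1.hasDerivWithinAt
  have h3 : HasFDerivAt (coordTrans E (γ u) p) (vecComp p (γ u))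
      (extChartAt 𝓘(ℝ, E) (γ u) (γ u)) := by
    rw [← fderiv_coordTrans_self]
    exact (ContDiffAt.differentiableAt_top (contDiffAt_coordTrans hself hp)).hasFDerivAt
  have h4 : (fun u => extChartAt 𝓘(ℝ, E) p (γ u)) =ᶠ[𝓝[s] u]
      fun t => coordTrans E (γ u) p (extChartAt 𝓘(ℝ, E) (γ u) (γ t)) := by
    filter_upwards [hγ.continuousWithinAt.eventually
      ((isOpen_extChartAt_source (I := 𝓘(ℝ, E)) (γ u)).mem_nhds hself)] with t ht
    rw [coordTrans, (extChartAt 𝓘(ℝ, E) (γ u)).left_inv ht]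
  have h5 := (h3.comp_hasDerivWithinAt u h2).congr_of_eventuallyEq h4
    (by simp [coordTrans])
  exact (h5.derivWithin hs).symm

variable {σ : ℝ → M} {k : ℕ} {t : ℕ → ℝ} {δ : ℝ} {x : ℝ × ℝ → M}

omit [IsManifold 𝓘(ℝ, E) ∞ M] in
lemma IsPiecewiseSmoothVariation.mono (hx : IsPiecewiseSmoothVariation E σ k t δ x) {δ' : ℝ}
    (h : δ' ≤ δ) : IsPiecewiseSmoothVariation E σ k t δ' x :=
  ⟨fun i hi => (hx.1 i hi).mono (prod_mono Subset.rfl (Ioo_subset_Ioo (neg_le_neg h) h)), hx.2⟩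

omit [IsManifold 𝓘(ℝ, E) ∞ M] in
lemma IsPiecewiseSmoothVariation.contMDiffAt_slice
    (hx : IsPiecewiseSmoothVariation E σ k t δ x) {i : ℕ} (hi : i < k) {u v : ℝ}
    (hu : u ∈ piece t i) (hv : v ∈ Ioo (-δ) δ) :
    ContMDiffAt 𝓘(ℝ, ℝ) 𝓘(ℝ, E) ∞ (fun v => x (u, v)) v := by
  have h1 : ContMDiffWithinAt 𝓘(ℝ, ℝ) 𝓘(ℝ, ℝ × ℝ) ∞ (fun v : ℝ => (u, v)) (Ioo (-δ) δ) v :=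
    contMDiffWithinAt_iff_contDiffWithinAt.2
      (contDiff_const.prodMk contDiff_id).contDiffWithinAt
  have h2 := (hx.1 i hi (u, v) ⟨hu, hv⟩).comp v h1 fun v' hv' => ⟨hu, hv'⟩
  exact h2.contMDiffAt (Ioo_mem_nhds hv.1 hv.2)

lemma IsPiecewiseSmoothVariation.contDiffAt_slice
    (hx : IsPiecewiseSmoothVariation E σ k t δ x) {i : ℕ} (hi : i < k) {u v : ℝ}
    (hu : u ∈ piece t i) (hv : v ∈ Ioo (-δ) δ) {p : M}
    (hp : x (u, v) ∈ (extChartAt 𝓘(ℝ, E) p).source) :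
    ContDiffAt ℝ ∞ (fun v => extChartAt 𝓘(ℝ, E) p (x (u, v))) v :=
  contDiffWithinAt_univ.1 (contDiffWithinAt_chart (hx.contMDiffAt_slice hi hu hv) hp)

/-- Displacement of a variation in a chart. -/
lemma exists_displacement (hδ : 0 < δ) (hx : IsPiecewiseSmoothVariation E σ k t δ x) (p : M)
    {χ : ℝ → ℝ} (hχ : ContDiff ℝ ∞ χ)
    (hsupp : ∀ i < k, ∀ u ∈ piece t i, u ∈ tsupport χ → σ u ∈ (extChartAt 𝓘(ℝ, E) p).source)
    {w : ℝ → E} (hw : ∀ i < k, ∀ u ∈ piece t i, σ u ∈ (extChartAt 𝓘(ℝ, E) p).source →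
      ContDiffWithinAt ℝ ∞ w (piece t i) u)
    {f : ℝ → ℝ} (hf : ContDiff ℝ ∞ f) (hf0 : f 0 = 0) :
    ∃ (δ' : ℝ) (x' : ℝ × ℝ → M), 0 < δ' ∧ δ' ≤ δ ∧ IsPiecewiseSmoothVariation E σ k t δ' x' ∧
      ∀ i < k, ∀ u ∈ piece t i, ∀ v ∈ Ioo (-δ') δ',
        (u ∉ tsupport χ → x' (u, v) = x (u, v)) ∧
        (u ∈ tsupport χ → x (u, v) ∈ (extChartAt 𝓘(ℝ, E) p).source ∧
          x' (u, v) ∈ (extChartAt 𝓘(ℝ, E) p).source ∧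
          extChartAt 𝓘(ℝ, E) p (x' (u, v)) =
            extChartAt 𝓘(ℝ, E) p (x (u, v)) + (χ u * f v) • w u) := by
  classical
  let y : ℝ × ℝ → E := fun z => extChartAt 𝓘(ℝ, E) p (x z) + (χ z.1 * f z.2) • w z.1
  -- The two formulas agree where `χ = 0` and `x` stays in the chart. Switching on the closed set
  -- `tsupport χ` thus leaves `x'` smooth across its boundary.
  let x' : ℝ × ℝ → M := fun z =>
    if z.1 ∈ tsupport χ then (extChartAt 𝓘(ℝ, E) p).symm (y z) else x z
  have hy : ∀ i < k, ∀ z ∈ piece t i ×ˢ Ioo (-δ) δ, x z ∈ (extChartAt 𝓘(ℝ, E) p).source →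
      σ z.1 ∈ (extChartAt 𝓘(ℝ, E) p).source →
      ContDiffWithinAt ℝ ∞ y (piece t i ×ˢ Ioo (-δ) δ) z := by
    intro i hi z hz hxz hσz
    have h1 : ContDiffWithinAt ℝ ∞ (fun z : ℝ × ℝ => w z.1) (piece t i ×ˢ Ioo (-δ) δ) z :=
      (hw i hi z.1 hz.1 hσz).comp z contDiffWithinAt_fst fun z hz => hz.1
    exact (contDiffWithinAt_chart (hx.1 i hi z hz) hxz).add
      (((hχ.comp contDiff_fst).mul (hf.comp contDiff_snd)).contDiffWithinAt.smul h1)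
  have hev : ∀ i < k, ∀ᶠ v in 𝓝 (0 : ℝ), ∀ u ∈ piece t i, u ∈ tsupport χ →
      x (u, v) ∈ (extChartAt 𝓘(ℝ, E) p).source ∧ y (u, v) ∈ (extChartAt 𝓘(ℝ, E) p).target := by
    intro i hi
    have hK : IsCompact (piece t i ∩ tsupport χ) := isCompact_Icc.inter_right (isClosed_tsupport χ)
    have h1 : ∀ u ∈ piece t i ∩ tsupport χ, ∀ᶠ z : ℝ × ℝ in 𝓝 ((u, 0) : ℝ × ℝ),
        z ∈ piece t i ×ˢ Ioo (-δ) δ → x z ∈ (extChartAt 𝓘(ℝ, E) p).source ∧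
          y z ∈ (extChartAt 𝓘(ℝ, E) p).target := by
      rintro u ⟨hu, hu'⟩
      have hz : ((u, 0) : ℝ × ℝ) ∈ piece t i ×ˢ Ioo (-δ) δ := ⟨hu, by simpa using hδ⟩
      have hσ := hsupp i hi u hu hu'
      have hxu : x (u, 0) = σ u := hx.2 i hi u hu
      have hs : x (u, 0) ∈ (extChartAt 𝓘(ℝ, E) p).source := by rwa [hxu]
      have hyu : y (u, 0) ∈ (extChartAt 𝓘(ℝ, E) p).target := by
        simpa [y, hf0] using (extChartAt 𝓘(ℝ, E) p).map_source hs
      rw [← eventually_nhdsWithin_iff]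
      exact ((hx.1 i hi _ hz).continuousWithinAt.eventually
        ((isOpen_extChartAt_source p).mem_nhds hs)).and
        ((hy i hi _ hz hs hσ).continuousWithinAt.eventually
          ((isOpen_extChartAt_target p).mem_nhds hyu))
    -- Tube lemma: by compactness one range of `v` works for all `u` in the support.
    have h2 := hK.eventually_forall_of_forall_eventually (x₀ := (0 : ℝ))
      (P := fun v u => (u, v) ∈ piece t i ×ˢ Ioo (-δ) δ →
        x (u, v) ∈ (extChartAt 𝓘(ℝ, E) p).source ∧ y (u, v) ∈ (extChartAt 𝓘(ℝ, E) p).target)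
      (fun u hu => by
        have := (continuous_swap.tendsto ((0 : ℝ), u)).eventually (h1 u hu)
        exact this)
    filter_upwards [h2, Ioo_mem_nhds (show -δ < 0 by linarith) hδ] with v hv hv' u hu hu'
    exact hv u ⟨hu, hu'⟩ ⟨hu, hv'⟩
  have hev' : ∀ᶠ v in 𝓝 (0 : ℝ), ∀ i ∈ Finset.range k, ∀ u ∈ piece t i, u ∈ tsupport χ →
      x (u, v) ∈ (extChartAt 𝓘(ℝ, E) p).source ∧ y (u, v) ∈ (extChartAt 𝓘(ℝ, E) p).target :=
    (Filter.eventually_all_finset _).2 fun i hi => hev i (Finset.mem_range.1 hi)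
  obtain ⟨ε, hε, hgood⟩ := exists_Ioo_of_eventually hev'
  have hδ' : min δ ε ≤ δ := min_le_left _ _
  have hsub : Ioo (-min δ ε) (min δ ε) ⊆ Ioo (-δ) δ := Ioo_subset_Ioo (neg_le_neg hδ') hδ'
  have hsub' : Ioo (-min δ ε) (min δ ε) ⊆ Ioo (-ε) ε :=
    Ioo_subset_Ioo (neg_le_neg (min_le_right _ _)) (min_le_right _ _)
  have hgood' : ∀ i < k, ∀ u ∈ piece t i, ∀ v ∈ Ioo (-min δ ε) (min δ ε), u ∈ tsupport χ →
      x (u, v) ∈ (extChartAt 𝓘(ℝ, E) p).source ∧ y (u, v) ∈ (extChartAt 𝓘(ℝ, E) p).target :=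
    fun i hi u hu v hv => hgood v (hsub' hv) i (Finset.mem_range.2 hi) u hu
  refine ⟨min δ ε, x', lt_min hδ hε, hδ', ⟨fun i hi z hz => ?_, fun i hi u hu => ?_⟩,
    fun i hi u hu v hv => ⟨fun h => if_neg h, fun h => ?_⟩⟩
  · have hz' : z ∈ piece t i ×ˢ Ioo (-δ) δ := ⟨hz.1, hsub hz.2⟩
    have hxz : ContMDiffWithinAt 𝓘(ℝ, ℝ × ℝ) 𝓘(ℝ, E) ∞ x
        (piece t i ×ˢ Ioo (-min δ ε) (min δ ε)) z :=
      (hx.1 i hi z hz').mono (prod_mono Subset.rfl hsub)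
    by_cases hzs : z.1 ∈ tsupport χ
    · have hg := hgood' i hi z.1 hz.1 z.2 hz.2 hzs
      have h1 := (hy i hi z hz' hg.1 (hsupp i hi _ hz.1 hzs)).mono
        (prod_mono (Subset.rfl (s := piece t i)) hsub)
      have h2 : ContMDiffAt 𝓘(ℝ, E) 𝓘(ℝ, E) ∞ (extChartAt 𝓘(ℝ, E) p).symm (y z) :=
        (contMDiffOn_extChartAt_symm p).contMDiffAt ((isOpen_extChartAt_target p).mem_nhds hg.2)
      have h3 := h2.comp_contMDiffWithinAt z (contMDiffWithinAt_iff_contDiffWithinAt.2 h1)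
      refine h3.congr_of_eventuallyEq ?_ (if_pos hzs)
      filter_upwards [hxz.continuousWithinAt.eventually
        ((isOpen_extChartAt_source (I := 𝓘(ℝ, E)) p).mem_nhds hg.1)] with z' hz'
      by_cases h : z'.1 ∈ tsupport χ
      · exact if_pos h
      · refine (if_neg h).trans ?_
        simp only [y, Function.comp_apply, image_eq_zero_of_notMem_tsupport h, zero_mul, zero_smul,
          add_zero]
        exact ((extChartAt 𝓘(ℝ, E) p).left_inv hz').symm
    · refine hxz.congr_of_eventuallyEq ?_ (if_neg hzs)
      have : ∀ᶠ z' : ℝ × ℝ in 𝓝 z, z'.1 ∉ tsupport χ :=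
        continuousAt_fst.eventually ((isClosed_tsupport χ).isOpen_compl.mem_nhds hzs)
      filter_upwards [mem_nhdsWithin_of_mem_nhds this] with z' hz'
      exact if_neg hz'
  · by_cases h : u ∈ tsupport χ
    · have hs := hsupp i hi u hu h
      refine (if_pos h).trans ?_
      simp only [y, hf0, hx.2 i hi u hu, mul_zero, zero_smul, add_zero]
      exact (extChartAt 𝓘(ℝ, E) p).left_inv hs
    · exact (if_neg h).trans (hx.2 i hi u hu)
  · have hg := hgood' i hi u hu v hv h
    have hx' : x' (u, v) = (extChartAt 𝓘(ℝ, E) p).symm (y (u, v)) := if_pos h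
    rw [hx']
    exact ⟨hg.1, (extChartAt 𝓘(ℝ, E) p).map_target hg.2, (extChartAt 𝓘(ℝ, E) p).right_inv hg.2⟩

end Curves

/-! ### Displacement along a field on the whole curve, chart by chart. -/

section Pass

variable {E : Type*} [NormedAddCommGroup E] [NormedSpace ℝ E]
  {M : Type*} [TopologicalSpace M] [ChartedSpace E M] [IsManifold 𝓘(ℝ, E) ∞ M]

/-- The components of the vector field `W` along `σ` are smooth on every closed interval of the
partition. -/
def HasSmoothComp (σ : ℝ → M) (k : ℕ) (t : ℕ → ℝ) (W : ℝ → E) : Prop :=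
  ∀ q : M, ∀ i < k, ∀ u ∈ piece t i, σ u ∈ (extChartAt 𝓘(ℝ, E) q).source →
    ContDiffWithinAt ℝ ∞ (fun u => vecComp q (σ u) (W u)) (piece t i) u

variable {σ : ℝ → M} {k : ℕ} {t : ℕ → ℝ} {δ : ℝ} {x : ℝ × ℝ → M}

/-- Displacement of a variation along a vector field, by means of functions `χ j` that are supported
in the domains of charts. -/
lemma exists_variation_add {ι : Type*} (hδ : 0 < δ) (hx : IsPiecewiseSmoothVariation E σ k t δ x)
    (p : ι → M) {χ : ι → ℝ → ℝ} (hχ : ∀ j, ContDiff ℝ ∞ (χ j))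
    (hsupp : ∀ j, ∀ i < k, ∀ u ∈ piece t i, u ∈ tsupport (χ j) →
      σ u ∈ (extChartAt 𝓘(ℝ, E) (p j)).source)
    {W : ℝ → E} (hW : HasSmoothComp σ k t W)
    {f : ℝ → ℝ} (hf : ContDiff ℝ ∞ f) (hf0 : f 0 = 0) (s : Finset ι) :
    ∃ (δ' : ℝ) (x' : ℝ × ℝ → M), 0 < δ' ∧ δ' ≤ δ ∧ IsPiecewiseSmoothVariation E σ k t δ' x' ∧
      ∀ i < k, ∀ u ∈ piece t i,
        (W u = 0 → ∀ v ∈ Ioo (-δ') δ', x' (u, v) = x (u, v)) ∧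
        ∀ q : M, σ u ∈ (extChartAt 𝓘(ℝ, E) q).source →
          deriv (fun v => extChartAt 𝓘(ℝ, E) q (x' (u, v))) 0 =
            deriv (fun v => extChartAt 𝓘(ℝ, E) q (x (u, v))) 0 +
              ((∑ j ∈ s, χ j u) * deriv f 0) • (vecComp q (σ u) (W u) : E) ∧
          (deriv f 0 = 0 → deriv (deriv (fun v => extChartAt 𝓘(ℝ, E) q (x' (u, v)))) 0 =
            deriv (deriv (fun v => extChartAt 𝓘(ℝ, E) q (x (u, v)))) 0 +
              ((∑ j ∈ s, χ j u) * deriv (deriv f) 0) • (vecComp q (σ u) (W u) : E)) := by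
  classical
  induction s using Finset.induction_on with
  | empty => exact ⟨δ, x, hδ, le_rfl, hx, fun i hi u hu => ⟨fun _ _ _ => rfl, by simp⟩⟩
  | insert j s hj ih =>
    obtain ⟨δ₁, x₁, hδ₁, hle₁, hx₁, h₁⟩ := ih
    obtain ⟨δ₂, x₂, hδ₂, hle₂, hx₂, h₂⟩ := exists_displacement hδ₁ hx₁ (p j) (hχ j) (hsupp j)
      (w := fun u => vecComp (p j) (σ u) (W u)) (hW (p j)) hf hf0
    have h0 : (0 : ℝ) ∈ Ioo (-δ₂) δ₂ := by simpa using hδ₂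
    have hsub : Ioo (-δ₂) δ₂ ⊆ Ioo (-δ₁) δ₁ := Ioo_subset_Ioo (neg_le_neg hle₂) hle₂
    refine ⟨δ₂, x₂, hδ₂, hle₂.trans hle₁, hx₂, fun i hi u hu => ⟨fun hWu v hv => ?_,
      fun q hq => ?_⟩⟩
    · rw [← (h₁ i hi u hu).1 hWu v (hsub hv)]
      by_cases h : u ∈ tsupport (χ j)
      · obtain ⟨ha, hb, hc⟩ := (h₂ i hi u hu v hv).2 h
        refine (extChartAt 𝓘(ℝ, E) (p j)).injOn hb ha ?_
        rw [hc, hWu, map_zero, smul_zero, add_zero]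
      · exact (h₂ i hi u hu v hv).1 h
    · obtain ⟨h₁a, h₁b⟩ := (h₁ i hi u hu).2 q hq
      rw [Finset.sum_insert hj, add_comm (χ j u), add_mul, add_mul, add_smul, add_smul,
        ← add_assoc, ← add_assoc, ← h₁a]
      -- It remains to see what the last displacement, from `x₁` to `x₂` in the chart at `p j`,
      -- contributes in the chart at `q`.
      suffices deriv (fun v => extChartAt 𝓘(ℝ, E) q (x₂ (u, v))) 0 =
            deriv (fun v => extChartAt 𝓘(ℝ, E) q (x₁ (u, v))) 0 +
              (χ j u * deriv f 0) • (vecComp q (σ u) (W u) : E) ∧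
          (deriv f 0 = 0 → deriv (deriv (fun v => extChartAt 𝓘(ℝ, E) q (x₂ (u, v)))) 0 =
            deriv (deriv (fun v => extChartAt 𝓘(ℝ, E) q (x₁ (u, v)))) 0 +
              (χ j u * deriv (deriv f) 0) • (vecComp q (σ u) (W u) : E)) from
        ⟨this.1, fun hf1 => by rw [← h₁b hf1, this.2 hf1]⟩
      have hIoo : Ioo (-δ₂) δ₂ ∈ 𝓝 (0 : ℝ) := Ioo_mem_nhds h0.1 h0.2
      by_cases h : u ∈ tsupport (χ j)
      · have hσ := hsupp j i hi u hu h
        have hx0 : x₁ (u, 0) = σ u := hx₁.2 i hi u hu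
        have hc := hx₁.contDiffAt_slice hi hu (hsub h0) (p := p j) (by rwa [hx0])
        have hφ := contDiffAt_coordTrans hσ hq
        rw [← hx0] at hφ
        have e1 : (fun v => extChartAt 𝓘(ℝ, E) q (x₁ (u, v))) =ᶠ[𝓝 0]
            fun v => coordTrans E (p j) q (extChartAt 𝓘(ℝ, E) (p j) (x₁ (u, v))) := by
          filter_upwards [hIoo] with v hv
          rw [coordTrans, (extChartAt 𝓘(ℝ, E) (p j)).left_inv ((h₂ i hi u hu v hv).2 h).1]
        have e2 : (fun v => extChartAt 𝓘(ℝ, E) q (x₂ (u, v))) =ᶠ[𝓝 0]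
            fun v => coordTrans E (p j) q (extChartAt 𝓘(ℝ, E) (p j) (x₁ (u, v)) +
              (χ j u * f v) • (vecComp (p j) (σ u) (W u) : E)) := by
          filter_upwards [hIoo] with v hv
          obtain ⟨-, hb, hc⟩ := (h₂ i hi u hu v hv).2 h
          rw [← hc, coordTrans, (extChartAt 𝓘(ℝ, E) (p j)).left_inv hb]
        rw [e1.deriv_eq, e2.deriv_eq, EventuallyEq.deriv_eq e1.deriv,
          EventuallyEq.deriv_eq e2.deriv, vecComp_eq hσ hq, ← hx0]
        exact ⟨deriv_comp_perturbation hφ hc hf hf0 _ _,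
          fun hf1 => deriv_deriv_comp_perturbation hφ hc hf hf0 hf1 _ _⟩
      · have e1 : (fun v => extChartAt 𝓘(ℝ, E) q (x₂ (u, v))) =ᶠ[𝓝 0]
            fun v => extChartAt 𝓘(ℝ, E) q (x₁ (u, v)) := by
          filter_upwards [hIoo] with v hv
          rw [(h₂ i hi u hu v hv).1 h]
        rw [e1.deriv_eq, EventuallyEq.deriv_eq e1.deriv, image_eq_zero_of_notMem_tsupport h]
        simp

omit [IsManifold 𝓘(ℝ, E) ∞ M] in
/-- A finite smooth partition of unity subordinate to the domains of charts that cover a curve. -/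
lemma exists_partition_charts {a b : ℝ} (hσ : ContinuousOn σ (Icc a b)) :
    ∃ (s : Finset ℝ) (χ : s → ℝ → ℝ), (∀ j, ContDiff ℝ ∞ (χ j)) ∧
      (∀ j, ∀ u ∈ Icc a b, u ∈ tsupport (χ j) → σ u ∈ (extChartAt 𝓘(ℝ, E) (σ j)).source) ∧
      ∀ u ∈ Icc a b, ∑ j, χ j u = 1 := by
  -- `σ` is continuous only on `[a, b]`, so preimages of chart domains are merely relatively open;
  -- the partition of unity on `ℝ` needs the open sets `U c`.
  have h1 : ∀ c : ℝ, ∃ U : Set ℝ, IsOpen U ∧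
      σ ⁻¹' (extChartAt 𝓘(ℝ, E) (σ c)).source ∩ Icc a b = U ∩ Icc a b := fun c =>
    (continuousOn_iff'.1 hσ) _ (isOpen_extChartAt_source _)
  choose U hU hUeq using h1
  have hcov : Icc a b ⊆ ⋃ c, U c := fun c hc => by
    have : c ∈ U c ∩ Icc a b := by
      rw [← hUeq]
      exact ⟨mem_extChartAt_source (σ c), hc⟩
    exact mem_iUnion.2 ⟨c, this.1⟩
  obtain ⟨s, hs⟩ := isCompact_Icc.elim_finite_subcover U hU hcov
  obtain ⟨f, hf⟩ := SmoothPartitionOfUnity.exists_isSubordinate 𝓘(ℝ, ℝ) (isClosed_Icc (a := a)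
    (b := b)) (fun j : s => U j) (fun j => hU j) (fun c hc => by simpa using hs hc)
  refine ⟨s, fun j => f j, fun j => (f j).contMDiff.contDiff, fun j u hu hju => ?_, fun u hu => ?_⟩
  · have : u ∈ U j ∩ Icc a b := ⟨hf j hju, hu⟩
    rw [← hUeq] at this
    exact this.1
  · rw [← f.sum_eq_one hu, finsum_eq_sum_of_fintype]

end Pass

/-! ### Partial derivatives on a strip that is closed in `u`. -/

section Slices

variable {F : Type*} [NormedAddCommGroup F] [NormedSpace ℝ F] {G : ℝ × ℝ → F} {I : Set ℝ}
  {δ u v : ℝ}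

lemma uniqueDiffOn_strip (hI : UniqueDiffOn ℝ I) : UniqueDiffOn ℝ (I ×ˢ Ioo (-δ) δ) :=
  hI.prod isOpen_Ioo.uniqueDiffOn

lemma hasDerivAt_transverse (hG : DifferentiableWithinAt ℝ G (I ×ˢ Ioo (-δ) δ) (u, v)) (hu : u ∈ I)
    (hv : v ∈ Ioo (-δ) δ) :
    HasDerivAt (fun v => G (u, v)) (fderivWithin ℝ G (I ×ˢ Ioo (-δ) δ) (u, v) (0, 1)) v := by
  have h1 : HasDerivWithinAt (fun v : ℝ => (u, v)) ((0 : ℝ), (1 : ℝ)) (Ioo (-δ) δ) v :=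
    ((hasDerivAt_const v u).prodMk (hasDerivAt_id v)).hasDerivWithinAt
  exact (hG.hasFDerivWithinAt.comp_hasDerivWithinAt (f := fun v : ℝ => (u, v)) v h1
    fun v' hv' => ⟨hu, hv'⟩).hasDerivAt (Ioo_mem_nhds hv.1 hv.2)

lemma hasDerivWithinAt_longitudinal
    (hG : DifferentiableWithinAt ℝ G (I ×ˢ Ioo (-δ) δ) (u, v)) (hv : v ∈ Ioo (-δ) δ) :
    HasDerivWithinAt (fun u => G (u, v)) (fderivWithin ℝ G (I ×ˢ Ioo (-δ) δ) (u, v) (1, 0)) I u := by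
  have h1 : HasDerivWithinAt (fun u : ℝ => (u, v)) ((1 : ℝ), (0 : ℝ)) I u :=
    ((hasDerivAt_id u).prodMk (hasDerivAt_const u v)).hasDerivWithinAt
  exact hG.hasFDerivWithinAt.comp_hasDerivWithinAt (f := fun u : ℝ => (u, v)) u h1
    fun u' hu' => ⟨hu', hv⟩

end Slices

/-! ### Velocities and accelerations of variations. -/

section Acceleration

variable {E : Type*} [NormedAddCommGroup E] [NormedSpace ℝ E]
  {M : Type*} [TopologicalSpace M] [ChartedSpace E M] [IsManifold 𝓘(ℝ, E) ∞ M]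

omit [IsManifold 𝓘(ℝ, E) ∞ M] in
-- Fields of the variation live over `x (u, 0)`, the given ones over `σ u`. Equality in the total
-- space avoids transport between these fibres.
lemma tangent_mk_eq {p q : M} (h : p = q) {w w' : E} (hw : w = w') :
    (⟨p, w⟩ : TangentBundle 𝓘(ℝ, E) M) = ⟨q, w'⟩ := by
  subst h hw
  rfl

variable {σ : ℝ → M} {k : ℕ} {t : ℕ → ℝ} {δ : ℝ} {x : ℝ × ℝ → M}

/-- Near `u` the `v`-derivatives are directional derivatives within the strip. The strip has unique
derivatives, so these are smooth up to the edges `t i` and `t (i + 1)`. -/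
lemma contDiffWithinAt_acceleration (hδ : 0 < δ) (hx : IsPiecewiseSmoothVariation E σ k t δ x)
    {i : ℕ} (hi : i < k) (hti : t i < t (i + 1)) {u : ℝ} (hu : u ∈ piece t i) {q : M}
    (hq : σ u ∈ (extChartAt 𝓘(ℝ, E) q).source) :
    ContDiffWithinAt ℝ ∞
      (fun u => deriv (deriv (fun v => extChartAt 𝓘(ℝ, E) q (x (u, v)))) 0) (piece t i) u := by
  let S := piece t i ×ˢ Ioo (-δ) δ
  have hS : UniqueDiffOn ℝ S := uniqueDiffOn_strip (uniqueDiffOn_Icc hti)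
  have h0 : (0 : ℝ) ∈ Ioo (-δ) δ := by simpa using hδ
  let G : ℝ × ℝ → E := fun z => extChartAt 𝓘(ℝ, E) q (x z)
  let G₁ : ℝ × ℝ → E := fun z => fderivWithin ℝ G S z (0, 1)
  let G₂ : ℝ × ℝ → E := fun z => fderivWithin ℝ G₁ S z (0, 1)
  have hG : ∀ z ∈ S, x z ∈ (extChartAt 𝓘(ℝ, E) q).source → ContDiffWithinAt ℝ ∞ G S z :=
    fun z hz hxz => contDiffWithinAt_chart (hx.1 i hi z hz) hxz
  have hG₁ : ∀ z ∈ S, x z ∈ (extChartAt 𝓘(ℝ, E) q).source → ContDiffWithinAt ℝ ∞ G₁ S z :=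
    fun z hz hxz => ((hG z hz hxz).fderivWithin_right hS (by simp) hz).clm_apply
      contDiffWithinAt_const
  have hG₂ : ∀ z ∈ S, x z ∈ (extChartAt 𝓘(ℝ, E) q).source → ContDiffWithinAt ℝ ∞ G₂ S z :=
    fun z hz hxz => ((hG₁ z hz hxz).fderivWithin_right hS (by simp) hz).clm_apply
      contDiffWithinAt_const
  have hx0 : ∀ u ∈ piece t i, x (u, 0) = σ u := hx.2 i hi
  have key : ∀ u' ∈ piece t i, x (u', 0) ∈ (extChartAt 𝓘(ℝ, E) q).source →
      deriv (deriv (fun v => extChartAt 𝓘(ℝ, E) q (x (u', v)))) 0 = G₂ (u', 0) := by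
    intro u' hu' hs
    have e1 : deriv (fun v => G (u', v)) =ᶠ[𝓝 0] fun v => G₁ (u', v) := by
      have hc := (hx.contMDiffAt_slice hi hu' h0).continuousAt
      filter_upwards [hc.eventually ((isOpen_extChartAt_source (I := 𝓘(ℝ, E)) q).mem_nhds hs),
        Ioo_mem_nhds h0.1 h0.2] with v hv hv'
      exact (hasDerivAt_transverse ((hG (u', v) ⟨hu', hv'⟩ hv).differentiableWithinAt (by simp))
        hu' hv').deriv
    refine (EventuallyEq.deriv_eq e1).trans ?_
    exact (hasDerivAt_transverse ((hG₁ (u', 0) ⟨hu', h0⟩ hs).differentiableWithinAt (by simp))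
        hu' h0).deriv
  have hmem : x (u, 0) ∈ (extChartAt 𝓘(ℝ, E) q).source := by rwa [hx0 u hu]
  have h1 : ContDiffWithinAt ℝ ∞ (fun u : ℝ => ((u, 0) : ℝ × ℝ)) (piece t i) u :=
    (contDiff_id.prodMk contDiff_const).contDiffWithinAt
  have hmaps : MapsTo (fun u : ℝ => ((u, 0) : ℝ × ℝ)) (piece t i) S := fun u' hu' => ⟨hu', h0⟩
  have h2 : ContDiffWithinAt ℝ ∞ (fun u => G₂ (u, 0)) (piece t i) u :=
    ContDiffWithinAt.comp (g := G₂) u (hG₂ (u, 0) ⟨hu, h0⟩ hmem) h1 hmaps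
  have hcont : ContinuousWithinAt (fun u => x (u, 0)) (piece t i) u :=
    (hx.1 i hi (u, 0) ⟨hu, h0⟩).continuousWithinAt.comp (f := fun u : ℝ => ((u, 0) : ℝ × ℝ))
      h1.continuousWithinAt hmaps
  refine h2.congr_of_eventuallyEq ?_ (key u hu hmem)
  filter_upwards [hcont.eventually
    ((isOpen_extChartAt_source (I := 𝓘(ℝ, E)) q).mem_nhds hmem), self_mem_nhdsWithin] with u' h h'
  exact key u' h' h

/-- Near the central curve, the velocities of the longitudinal curves stay in an open set. -/
lemma eventually_longVelocity_mem (hδ : 0 < δ) (hx : IsPiecewiseSmoothVariation E σ k t δ x)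
    {i : ℕ} (hi : i < k) (hti : t i < t (i + 1)) {N : TangentBundle 𝓘(ℝ, E) M → Prop}
    (hN : ∀ u ∈ piece t i,
      ∀ᶠ v in 𝓝 (⟨x (u, 0), longVelocity x (piece t i) u 0⟩ : TangentBundle 𝓘(ℝ, E) M), N v) :
    ∀ᶠ v in 𝓝 (0 : ℝ), ∀ u ∈ piece t i, N ⟨x (u, v), longVelocity x (piece t i) u v⟩ := by
  let S := piece t i ×ˢ Ioo (-δ) δ
  have hI : UniqueDiffOn ℝ (piece t i) := uniqueDiffOn_Icc hti
  have hS : UniqueDiffOn ℝ S := uniqueDiffOn_strip hI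
  have h0 : (0 : ℝ) ∈ Ioo (-δ) δ := by simpa using hδ
  let Y : ℝ × ℝ → TangentBundle 𝓘(ℝ, E) M := fun z => ⟨x z, longVelocity x (piece t i) z.1 z.2⟩
  -- The lifted variation is jointly continuous: in a bundle chart it consists of `x` and its
  -- `u`-derivative within the strip.
  have hY : ∀ u ∈ piece t i, ContinuousWithinAt Y S (u, 0) := by
    intro u hu
    let q := x (u, 0)
    have hz : (u, (0 : ℝ)) ∈ S := ⟨hu, h0⟩
    have hq : x (u, 0) ∈ (extChartAt 𝓘(ℝ, E) q).source := mem_extChartAt_source q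
    let G : ℝ × ℝ → E := fun z => extChartAt 𝓘(ℝ, E) q (x z)
    have hG : ∀ z ∈ S, x z ∈ (extChartAt 𝓘(ℝ, E) q).source → ContDiffWithinAt ℝ ∞ G S z :=
      fun z hz hxz => contDiffWithinAt_chart (hx.1 i hi z hz) hxz
    have hG₁ : ContDiffWithinAt ℝ ∞ (fun z => fderivWithin ℝ G S z (1, 0)) S (u, 0) :=
      ((hG _ hz hq).fderivWithin_right hS (by simp) hz).clm_apply contDiffWithinAt_const
    have key : ∀ z ∈ S, x z ∈ (extChartAt 𝓘(ℝ, E) q).source →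
        tangentChart q (Y z) = (G z, fderivWithin ℝ G S z (1, 0)) := by
      intro z hz hxz
      have hslice : ContMDiffWithinAt 𝓘(ℝ, ℝ) 𝓘(ℝ, E) ∞ (fun u' => x (u', z.2)) (piece t i) z.1 := by
        have h1 : ContMDiffWithinAt 𝓘(ℝ, ℝ) 𝓘(ℝ, ℝ × ℝ) ∞ (fun u' : ℝ => (u', z.2))
            (piece t i) z.1 :=
          contMDiffWithinAt_iff_contDiffWithinAt.2
            (contDiff_id.prodMk contDiff_const).contDiffWithinAt
        have hmaps : MapsTo (fun u' : ℝ => (u', z.2)) (piece t i) S := fun u' hu' => ⟨hu', hz.2⟩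
        exact (hx.1 i hi z hz).comp z.1 h1 hmaps
      rw [tangentChart_apply]
      refine Prod.ext rfl ?_
      refine (vecComp_velocity hslice (hI _ hz.1) hxz).trans ?_
      exact (hasDerivWithinAt_longitudinal ((hG z hz hxz).differentiableWithinAt (by simp))
        hz.2).derivWithin (hI _ hz.1)
    have hev : ∀ᶠ z in 𝓝[S] (u, (0 : ℝ)), x z ∈ (extChartAt 𝓘(ℝ, E) q).source :=
      (hx.1 i hi _ hz).continuousWithinAt.eventually ((isOpen_extChartAt_source q).mem_nhds hq)
    have h1 : Tendsto (fun z => tangentChart q (Y z)) (𝓝[S] (u, (0 : ℝ)))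
        (𝓝 (tangentChart q (Y (u, 0)))) := by
      have h2 : ContinuousWithinAt (fun z => (G z, fderivWithin ℝ G S z (1, 0))) S (u, 0) :=
        (hG _ hz hq).continuousWithinAt.prodMk hG₁.continuousWithinAt
      rw [key _ hz hq]
      refine h2.tendsto.congr' ?_
      filter_upwards [hev, self_mem_nhdsWithin] with z h1 h2
      exact (key z h2 h1).symm
    have h3 := (continuousAt_tangentChart_symm (v := Y (u, 0)) hq).comp h1
    refine h3.congr' ?_
    filter_upwards [hev] with z h
    exact (tangentChart q).left_inv (mem_tangentChart_source.2 h)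
  have hK : IsCompact (piece t i) := isCompact_Icc
  have h2 := hK.eventually_forall_of_forall_eventually (x₀ := (0 : ℝ))
    (P := fun v u => (u, v) ∈ S → N (Y (u, v)))
    (fun u hu => by
      have h1 : ∀ᶠ z : ℝ × ℝ in 𝓝 ((u, 0) : ℝ × ℝ), z ∈ S → N (Y z) := by
        rw [← eventually_nhdsWithin_iff]
        exact (hY u hu).eventually (hN u hu)
      exact (continuous_swap.tendsto ((0 : ℝ), u)).eventually h1)
  filter_upwards [h2, Ioo_mem_nhds h0.1 h0.2] with v hv hv' u hu
  exact hv u hu ⟨hu, hv'⟩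

/-- At interior partition points the left-hand side is a one-sided derivative. It agrees with the
velocity on `[a, b]` since `σ` is smooth there. -/
lemma longVelocity_zero (hx : IsPiecewiseSmoothVariation E σ k t δ x) {i : ℕ} (hi : i < k)
    (hti : t i < t (i + 1)) {a b : ℝ} (hab : piece t i ⊆ Icc a b)
    (hσ : ContMDiffOn 𝓘(ℝ, ℝ) 𝓘(ℝ, E) ∞ σ (Icc a b)) {u : ℝ} (hu : u ∈ piece t i) :
    (⟨x (u, 0), longVelocity x (piece t i) u 0⟩ : TangentBundle 𝓘(ℝ, E) M) =
      ⟨σ u, velocity σ (Icc a b) u⟩ := by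
  have hI : UniqueDiffOn ℝ (piece t i) := uniqueDiffOn_Icc hti
  have hab' : a < b := by
    have h1 := hab (left_mem_Icc.2 hti.le)
    have h2 := hab (right_mem_Icc.2 hti.le)
    linarith [h1.1, h2.2]
  have heq : ∀ u ∈ piece t i, x (u, 0) = σ u := hx.2 i hi
  have hself : σ u ∈ (extChartAt 𝓘(ℝ, E) (σ u)).source := mem_extChartAt_source _
  have hσu := hσ u (hab hu)
  have hs : ContMDiffWithinAt 𝓘(ℝ, ℝ) 𝓘(ℝ, E) ∞ (fun u => x (u, 0)) (piece t i) u :=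
    (hσu.mono hab).congr heq (heq u hu)
  have h1 := vecComp_velocity (p := σ u) hs (hI u hu) (by rwa [heq u hu])
  have h2 := vecComp_velocity hσu (uniqueDiffOn_Icc hab' u (hab hu)) hself
  have h3 : derivWithin (fun u' => extChartAt 𝓘(ℝ, E) (σ u) (x (u', 0))) (piece t i) u =
      derivWithin (fun u' => extChartAt 𝓘(ℝ, E) (σ u) (σ u')) (Icc a b) u := by
    rw [derivWithin_congr (fun u' hu' => by rw [heq u' hu']) (by rw [heq u hu])]
    exact derivWithin_subset hab (hI u hu)
      ((contDiffWithinAt_chart hσu hself).differentiableWithinAt (by simp))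
  have h4 : ∀ p : M, p = σ u → ∀ w : E, vecComp (σ u) p w = w := by
    rintro _ rfl w
    exact vecComp_self _ w
  refine tangent_mk_eq (heq u hu) ?_
  rw [h3, ← h2] at h1
  exact (h4 _ (heq u hu) _).symm.trans (h1.trans (h4 _ rfl _))

lemma velocity_eq_deriv {γ : ℝ → M} {v : ℝ} (hδ : v ∈ Ioo (-δ) δ)
    (hγ : ContMDiffAt 𝓘(ℝ, ℝ) 𝓘(ℝ, E) ∞ γ v) {p : M}
    (hp : γ v ∈ (extChartAt 𝓘(ℝ, E) p).source) :
    (vecComp p (γ v) : E →L[ℝ] E) (velocity γ (Ioo (-δ) δ) v) =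
      deriv (fun v => extChartAt 𝓘(ℝ, E) p (γ v)) v := by
  rw [vecComp_velocity hγ.contMDiffWithinAt (isOpen_Ioo.uniqueDiffWithinAt hδ) hp,
    derivWithin_of_isOpen isOpen_Ioo hδ]

lemma velocity_eq_deriv_self {γ : ℝ → M} {v : ℝ} (hδ : v ∈ Ioo (-δ) δ)
    (hγ : ContMDiffAt 𝓘(ℝ, ℝ) 𝓘(ℝ, E) ∞ γ v) :
    velocity (E := E) γ (Ioo (-δ) δ) v = deriv (fun v' => extChartAt 𝓘(ℝ, E) (γ v) (γ v')) v :=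
  (vecComp_self (E := E) _ _).symm.trans (velocity_eq_deriv hδ hγ (mem_extChartAt_source _))

/-- The acceleration of a curve in the preferred chart at a point of it. -/
lemma covDeriv_velocity {L : TangentBundle 𝓘(ℝ, E) M → ℝ} {γ : ℝ → M} (hδ : 0 < δ)
    (hγ : ∀ v ∈ Ioo (-δ) δ, ContMDiffAt 𝓘(ℝ, ℝ) 𝓘(ℝ, E) ∞ γ v)
    (W : (v : ℝ) → TangentSpace 𝓘(ℝ, E) (γ v)) :
    covDeriv L γ (Ioo (-δ) δ) W (fun v => velocity γ (Ioo (-δ) δ) v) 0 =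
      deriv (deriv (fun v => extChartAt 𝓘(ℝ, E) (γ 0) (γ v))) 0 +
        chernSymbol L (⟨γ 0, W 0⟩ : TangentBundle 𝓘(ℝ, E) M)
          (deriv (fun v => extChartAt 𝓘(ℝ, E) (γ 0) (γ v)) 0)
          (deriv (fun v => extChartAt 𝓘(ℝ, E) (γ 0) (γ v)) 0) := by
  have h0 : (0 : ℝ) ∈ Ioo (-δ) δ := by simpa using hδ
  have hIoo := Ioo_mem_nhds h0.1 h0.2
  have h1 : derivWithin (fun v => (tangentChart (γ 0)
      (⟨γ v, velocity γ (Ioo (-δ) δ) v⟩ : TangentBundle 𝓘(ℝ, E) M)).2) (Ioo (-δ) δ) 0 =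
      deriv (deriv (fun v => extChartAt 𝓘(ℝ, E) (γ 0) (γ v))) 0 := by
    rw [derivWithin_of_isOpen isOpen_Ioo h0]
    refine EventuallyEq.deriv_eq ?_
    filter_upwards [hIoo, (hγ 0 h0).continuousAt.eventually
      ((isOpen_extChartAt_source (I := 𝓘(ℝ, E)) (γ 0)).mem_nhds (mem_extChartAt_source _))]
      with v hv hv'
    exact velocity_eq_deriv hv (hγ v hv) hv'
  rw [covDeriv, h1, velocity_eq_deriv_self h0 (hγ 0 h0)]

variable [FiniteDimensional ℝ E]

/-- The components, in an arbitrary chart, of the acceleration of a curve. -/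
lemma vecComp_acceleration (F : FinslerSpacetime E M) {q : M} {r : TangentBundle 𝓘(ℝ, E) M}
    (hr : r ∈ F.Astar) (hreg : IsRegularAt F.L r) (hq : r.proj ∈ (extChartAt 𝓘(ℝ, E) q).source)
    {γ : ℝ → M} (hγ : ContMDiffAt 𝓘(ℝ, ℝ) 𝓘(ℝ, E) ∞ γ 0) (h0 : γ 0 = r.proj) {w : E}
    (hw : deriv (fun v => extChartAt 𝓘(ℝ, E) r.proj (γ v)) 0 = w) :
    (vecComp q r.proj : E →L[ℝ] E) (deriv (deriv (fun v => extChartAt 𝓘(ℝ, E) r.proj (γ v))) 0 +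
        chernSymbol F.L r w w) =
      deriv (deriv (fun v => extChartAt 𝓘(ℝ, E) q (γ v))) 0 +
        localChern (chartL F.L q) (tangentChart q r) (vecComp q r.proj w) (vecComp q r.proj w) := by
  have hself : r.proj ∈ (extChartAt 𝓘(ℝ, E) r.proj).source := mem_extChartAt_source _
  have hφ := contDiffAt_coordTrans hself hq
  have hy : ContDiffAt ℝ ∞ (fun v => extChartAt 𝓘(ℝ, E) r.proj (γ v)) 0 :=
    contDiffWithinAt_univ.1 (contDiffWithinAt_chart hγ (by rwa [h0]))
  have e1 : (fun v => extChartAt 𝓘(ℝ, E) q (γ v)) =ᶠ[𝓝 0]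
      fun v => coordTrans E r.proj q (extChartAt 𝓘(ℝ, E) r.proj (γ v)) := by
    filter_upwards [hγ.continuousAt.eventually
      ((isOpen_extChartAt_source (I := 𝓘(ℝ, E)) r.proj).mem_nhds (by rwa [h0]))] with v hv
    rw [coordTrans, (extChartAt 𝓘(ℝ, E) r.proj).left_inv hv]
  -- Both the transformed Christoffel symbol and the second derivative in the chart at `q` produce
  -- the second derivative of the coordinate change at `(w, w)`; this makes acceleration a vector.
  rw [EventuallyEq.deriv_eq e1.deriv, map_add, vecComp_chernSymbol F hr hreg hq,
    deriv_deriv_comp (φ := coordTrans E r.proj q) (by rwa [h0]) hy, h0, hw, fderiv_coordTrans_self]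
  abel

end Acceleration

/-! ### Construction of the variation. -/

section Variation

variable {E : Type*} [NormedAddCommGroup E] [NormedSpace ℝ E] [FiniteDimensional ℝ E]
  {M : Type*} [TopologicalSpace M] [ChartedSpace E M] [IsManifold 𝓘(ℝ, E) ∞ M]

lemma IsPartition.piece_subset {a b : ℝ} {k : ℕ} {t : ℕ → ℝ} (ht : IsPartition a b k t) {i : ℕ}
    (hi : i < k) : piece t i ⊆ Icc a b := by
  obtain ⟨h0, hk, hlt⟩ := ht
  have hmono : ∀ j ≤ k, ∀ i ≤ j, t i ≤ t j := by
    intro j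
    induction j with
    | zero => intro _ i hi; rw [Nat.le_zero.1 hi]
    | succ j ih =>
      intro hj i hi
      rcases Nat.le_succ_iff.1 hi with h | h
      · exact (ih (by omega) i h).trans (hlt j (by omega)).le
      · rw [h]
  refine Icc_subset_Icc ?_ ?_
  · rw [← h0]
    exact hmono i hi.le 0 (Nat.zero_le i)
  · rw [← hk]
    exact hmono k le_rfl (i + 1) hi

variable {F : FinslerSpacetime E M} {σ : ℝ → M} {a b : ℝ} {k : ℕ} {t : ℕ → ℝ}

/-- The velocity of the curve `σ` on `[a, b]` as an element of the tangent bundle. -/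
def velocityLift (σ : ℝ → M) (a b u : ℝ) : TangentBundle 𝓘(ℝ, E) M := ⟨σ u, velocity σ (Icc a b) u⟩

omit [FiniteDimensional ℝ E] in
lemma FinslerSpacetime.IsGeodesic.mem_Astar (hσ : F.IsGeodesic σ a b) {u : ℝ} (hu : u ∈ Icc a b) :
    velocityLift σ a b u ∈ F.Astar :=
  F.closure_subset_Astar _ (hσ.2 u hu).2.1 (hσ.2 u hu).1

omit [FiniteDimensional ℝ E] in
lemma FinslerSpacetime.IsGeodesic.isRegularAt (hσ : F.IsGeodesic σ a b) {u : ℝ}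
    (hu : u ∈ Icc a b) : IsRegularAt F.L (velocityLift σ a b u) :=
  (hσ.2 u hu).2.2.1

omit [FiniteDimensional ℝ E] in
lemma contDiffWithinAt_velocityLift (hab : a < b) (hσ : ContMDiffOn 𝓘(ℝ, ℝ) 𝓘(ℝ, E) ∞ σ (Icc a b))
    {u : ℝ} (hu : u ∈ Icc a b) {q : M} (hq : σ u ∈ (extChartAt 𝓘(ℝ, E) q).source) :
    ContDiffWithinAt ℝ ∞ (fun u => tangentChart q (velocityLift (E := E) σ a b u)) (Icc a b) u := by
  have hI := uniqueDiffOn_Icc hab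
  have h1 := contDiffWithinAt_chart (hσ u hu) hq
  have h2 : ContDiffWithinAt ℝ ∞
      (fun u => derivWithin (fun u => extChartAt 𝓘(ℝ, E) q (σ u)) (Icc a b) u) (Icc a b) u := by
    exact (h1.fderivWithin_right hI (m := ∞) (by simp) hu).clm_apply
      (contDiffWithinAt_const (c := (1 : ℝ)))
  refine (h1.prodMk h2).congr_of_eventuallyEq_of_mem ?_ hu
  filter_upwards [(hσ u hu).continuousWithinAt.eventually
    ((isOpen_extChartAt_source (I := 𝓘(ℝ, E)) q).mem_nhds hq), self_mem_nhdsWithin] with u' h h'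
  rw [tangentChart_apply]
  exact Prod.ext rfl (vecComp_velocity (hσ u' h') (hI u' h') h)

/-- The acceleration of the variation `x` with variation field `V`, in terms of the velocities of
the central curve `σ`. -/
def centralAccel (L : TangentBundle 𝓘(ℝ, E) M → ℝ) (σ : ℝ → M) (a b : ℝ) (x : ℝ × ℝ → M)
    (V : ℝ → E) (u : ℝ) : E :=
  deriv (deriv (fun v => extChartAt 𝓘(ℝ, E) (σ u) (x (u, v)))) 0 +
    chernSymbol L (velocityLift σ a b u) (V u) (V u)

/-- In `centralAccel` the chart moves with `u`, which hides smoothness. In a fixed chart the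
components are a smooth second derivative plus `localChern` along the smooth velocity of `σ`. -/
lemma hasSmoothComp_centralAccel (hab : a < b) (hσ : F.IsGeodesic σ a b) (ht : IsPartition a b k t)
    {δ : ℝ} (hδ : 0 < δ) {x : ℝ × ℝ → M} (hx : IsPiecewiseSmoothVariation E σ k t δ x)
    {V : ℝ → E} (hV : HasSmoothComp σ k t V)
    (hxV : ∀ i < k, ∀ u ∈ piece t i,
      deriv (fun v => extChartAt 𝓘(ℝ, E) (σ u) (x (u, v))) 0 = V u) :
    HasSmoothComp σ k t (centralAccel F.L σ a b x V) := by
  intro q i hi u hu hq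
  have hsub := ht.piece_subset hi
  have h0 : (0 : ℝ) ∈ Ioo (-δ) δ := by simpa using hδ
  have key : ∀ u' ∈ piece t i, σ u' ∈ (extChartAt 𝓘(ℝ, E) q).source →
      (vecComp q (σ u') (centralAccel F.L σ a b x V u') : E) =
        deriv (deriv (fun v => extChartAt 𝓘(ℝ, E) q (x (u', v)))) 0 +
        localChern (chartL F.L q) (tangentChart q (velocityLift σ a b u'))
          (vecComp q (σ u') (V u')) (vecComp q (σ u') (V u')) := fun u' hu' hq' =>
    vecComp_acceleration F (r := velocityLift σ a b u') (hσ.mem_Astar (hsub hu'))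
      (hσ.isRegularAt (hsub hu')) hq' (hx.contMDiffAt_slice hi hu' h0) (hx.2 i hi u' hu')
      (hxV i hi u' hu')
  have h1 := contDiffWithinAt_acceleration hδ hx hi (ht.2.2 i hi) hu hq
  have h2 := hV q i hi u hu hq
  have h3 : ContDiffWithinAt ℝ ∞ (fun u' => localChern (chartL F.L q)
      (tangentChart q (velocityLift (E := E) σ a b u'))) (piece t i) u :=
    ContDiffAt.comp_contDiffWithinAt (g := localChern (chartL F.L q)) u
      (locallyRegular_chartL F (hσ.mem_Astar (hsub hu)) (hσ.isRegularAt (hsub hu))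
        hq).contDiffAt_localChern
      ((contDiffWithinAt_velocityLift hab hσ.1 (hsub hu) hq).mono hsub)
  refine (h1.add ((h3.clm_apply h2).clm_apply h2)).congr_of_eventuallyEq_of_mem ?_ hu
  filter_upwards [((hσ.1 u (hsub hu)).continuousWithinAt.mono hsub).eventually
    ((isOpen_extChartAt_source (I := 𝓘(ℝ, E)) q).mem_nhds hq), self_mem_nhdsWithin] with u' h h'
  exact key u' h' h

omit [FiniteDimensional ℝ E] in
/-- The acceleration field of a variation, in the preferred charts at the central curve. -/
lemma accelField_eq_centralAccel {L : TangentBundle 𝓘(ℝ, E) M → ℝ} {δ : ℝ} (hδ : 0 < δ)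
    {x : ℝ × ℝ → M} (hx : IsPiecewiseSmoothVariation E σ k t δ x) (ht : IsPartition a b k t)
    (hσ : ContMDiffOn 𝓘(ℝ, ℝ) 𝓘(ℝ, E) ∞ σ (Icc a b)) {i : ℕ} (hi : i < k) {u : ℝ}
    (hu : u ∈ piece t i) {V : ℝ → E}
    (hV : deriv (fun v => extChartAt 𝓘(ℝ, E) (σ u) (x (u, v))) 0 = V u) :
    accelField L x (piece t i) δ u = centralAccel L σ a b x V u := by
  have h1 := covDeriv_velocity (L := L) (γ := fun v => x (u, v)) hδ
    (fun v hv => hx.contMDiffAt_slice hi hu hv) (fun v => longVelocity x (piece t i) u v)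
  have h2 := longVelocity_zero hx hi (ht.2.2 i hi) (ht.piece_subset hi) hσ hu
  refine h1.trans ?_
  rw [centralAccel, velocityLift, ← h2, ← hV, ← hx.2 i hi u hu]

/-- Every pair of piecewise smooth fields along a geodesic which vanish at the endpoints consists of
the variation field and the acceleration field of a variation with fixed endpoints. -/
theorem exists_variation (hab : a < b) (hσ : F.IsGeodesic σ a b) (ht : IsPartition a b k t)
    {V A : (u : ℝ) → TangentSpace 𝓘(ℝ, E) (σ u)} (hV : IsPiecewiseSmoothField σ k t V)
    (hA : IsPiecewiseSmoothField σ k t A) :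
    ∃ (δ : ℝ) (x : ℝ × ℝ → M), 0 < δ ∧ IsPiecewiseSmoothVariation E σ k t δ x ∧
      (∀ i < k, ∀ u ∈ piece t i, V u = 0 → A u = 0 → ∀ v ∈ Ioo (-δ) δ, x (u, v) = σ u) ∧
      ∀ i < k, ∀ u ∈ piece t i,
        (∀ v ∈ Ioo (-δ) δ,
          (⟨x (u, v), longVelocity x (piece t i) u v⟩ : TangentBundle 𝓘(ℝ, E) M) ∈ F.Astar ∧
          IsRegularAt F.L
            (⟨x (u, v), longVelocity x (piece t i) u v⟩ : TangentBundle 𝓘(ℝ, E) M)) ∧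
        (⟨x (u, 0), transVelocity x δ u 0⟩ : TangentBundle 𝓘(ℝ, E) M) = ⟨σ u, V u⟩ ∧
        (⟨x (u, 0), accelField F.L x (piece t i) δ u⟩ : TangentBundle 𝓘(ℝ, E) M) =
          ⟨σ u, A u⟩ := by
  obtain ⟨s, χ, hχ, hsupp, hsum⟩ := exists_partition_charts (E := E) hσ.1.continuousOn
  have hsupp' : ∀ j, ∀ i < k, ∀ u ∈ piece t i, u ∈ tsupport (χ j) →
      σ u ∈ (extChartAt 𝓘(ℝ, E) (σ j)).source :=
    fun j i hi u hu => hsupp j u (ht.piece_subset hi hu)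
  have hsum' : ∀ i < k, ∀ u ∈ piece t i, ∑ j, χ j u = 1 :=
    fun i hi u hu => hsum u (ht.piece_subset hi hu)
  let V' : ℝ → E := V
  let A' : ℝ → E := A
  have hV' : HasSmoothComp σ k t V' := fun q i hi u hu hq =>
    contDiffWithinAt_vecComp (hV i hi u hu) hq
  have hA' : HasSmoothComp σ k t A' := fun q i hi u hu hq =>
    contDiffWithinAt_vecComp (hA i hi u hu) hq
  -- The constant variation; its width `1` is arbitrary.
  have hx₀ : IsPiecewiseSmoothVariation E σ k t 1 fun z => σ z.1 := by
    refine ⟨fun i hi => ?_, fun _ _ _ _ => rfl⟩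
    exact hσ.1.comp contDiff_fst.contMDiff.contMDiffOn fun z hz => ht.piece_subset hi hz.1
  -- First pass, with `f v = v`: it produces the variation field.
  obtain ⟨δ₁, x₁, hδ₁, -, hx₁, h₁⟩ := exists_variation_add one_pos hx₀ (fun j : s => σ j) hχ hsupp'
    hV' (f := fun v => v) contDiff_id rfl Finset.univ
  have hx₁V : ∀ i < k, ∀ u ∈ piece t i,
      deriv (fun v => extChartAt 𝓘(ℝ, E) (σ u) (x₁ (u, v))) 0 = V' u := fun i hi u hu => by
    rw [((h₁ i hi u hu).2 (σ u) (mem_extChartAt_source _)).1, hsum' i hi u hu, vecComp_self]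
    simp
  -- The error in the acceleration, which the second pass removes with `f v = v ^ 2 / 2`: there `f 0
  -- = f' 0 = 0` and `f'' 0 = 1`.
  let B : ℝ → E := fun u => A' u - centralAccel F.L σ a b x₁ V' u
  have hB : HasSmoothComp σ k t B := fun q i hi u hu hq => by
    simp only [B, map_sub]
    exact (hA' q i hi u hu hq).sub
      (hasSmoothComp_centralAccel hab hσ ht hδ₁ hx₁ hV' hx₁V q i hi u hu hq)
  have hf : deriv (fun v : ℝ => v ^ 2 / 2) = fun v => v := by
    ext v
    simp
  obtain ⟨δ₂, x₂, hδ₂, hle, hx₂, h₂⟩ := exists_variation_add hδ₁ hx₁ (fun j : s => σ j) hχ hsupp'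
    hB (f := fun v => v ^ 2 / 2) ((contDiff_id.pow 2).div_const 2) (by simp) Finset.univ
  have hx₂V : ∀ i < k, ∀ u ∈ piece t i,
      deriv (fun v => extChartAt 𝓘(ℝ, E) (σ u) (x₂ (u, v))) 0 = V' u := fun i hi u hu => by
    rw [((h₂ i hi u hu).2 (σ u) (mem_extChartAt_source _)).1, hx₁V i hi u hu, hf]
    simp
  have hx₂A : ∀ i < k, ∀ u ∈ piece t i, centralAccel F.L σ a b x₂ V' u = A' u :=
    fun i hi u hu => by
    have h3 := ((h₂ i hi u hu).2 (σ u) (mem_extChartAt_source _)).2 (by rw [hf])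
    rw [hf, hsum' i hi u hu, vecComp_self] at h3
    rw [centralAccel, h3]
    simp only [B, centralAccel, deriv_id'', mul_one, one_smul]
    abel
  have hvel : ∀ i < k, ∀ u ∈ piece t i, (⟨x₂ (u, 0), longVelocity x₂ (piece t i) u 0⟩ :
      TangentBundle 𝓘(ℝ, E) M) = velocityLift σ a b u := fun i hi u hu =>
    longVelocity_zero hx₂ hi (ht.2.2 i hi) (ht.piece_subset hi) hσ.1 hu
  have hev : ∀ᶠ v in 𝓝 (0 : ℝ), ∀ i ∈ Finset.range k, ∀ u ∈ piece t i,
      (⟨x₂ (u, v), longVelocity x₂ (piece t i) u v⟩ : TangentBundle 𝓘(ℝ, E) M) ∈ F.Astar ∧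
      IsRegularAt F.L
        (⟨x₂ (u, v), longVelocity x₂ (piece t i) u v⟩ : TangentBundle 𝓘(ℝ, E) M) := by
    refine (Filter.eventually_all_finset _).2 fun i hi => ?_
    have hi := Finset.mem_range.1 hi
    refine eventually_longVelocity_mem (N := fun v => v ∈ F.Astar ∧ IsRegularAt F.L v) hδ₂ hx₂ hi
      (ht.2.2 i hi) fun u hu => ?_
    have hu' := ht.piece_subset hi hu
    rw [hvel i hi u hu]
    exact Filter.Eventually.and (F.isOpen_Astar.mem_nhds (hσ.mem_Astar hu'))
      (hσ.isRegularAt hu').eventually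
  obtain ⟨ε, hε, hreg⟩ := exists_Ioo_of_eventually hev
  have hδ : 0 < min δ₂ ε := lt_min hδ₂ hε
  have hx := hx₂.mono (min_le_left δ₂ ε)
  refine ⟨min δ₂ ε, x₂, hδ, hx, fun i hi u hu hVu hAu v hv => ?_, fun i hi u hu => ⟨fun v hv => ?_,
    tangent_mk_eq (hx.2 i hi u hu) ?_, tangent_mk_eq (hx.2 i hi u hu) ?_⟩⟩
  · have hc : ∀ v ∈ Ioo (-δ₁) δ₁, x₁ (u, v) = σ u := (h₁ i hi u hu).1 hVu
    have hc' : (fun v => extChartAt 𝓘(ℝ, E) (σ u) (x₁ (u, v))) =ᶠ[𝓝 0]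
        fun _ => extChartAt 𝓘(ℝ, E) (σ u) (σ u) := by
      filter_upwards [Ioo_mem_nhds (show -δ₁ < 0 by linarith) hδ₁] with v hv
      rw [hc v hv]
    have hVu' : V' u = 0 := hVu
    have hAu' : A' u = 0 := hAu
    -- Where `V` vanishes, `x₁ (u, ·)` is constant near `0`, so its acceleration vanishes; with `A u
    -- = 0` the second pass does not move it either.
    have hBu : B u = 0 := by
      simp only [B, centralAccel, hVu', hAu', EventuallyEq.deriv_eq hc'.deriv, map_zero]
      simp
    have hv' : v ∈ Ioo (-δ₂) δ₂ :=
      Ioo_subset_Ioo (neg_le_neg (min_le_left _ _)) (min_le_left _ _) hv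
    rw [(h₂ i hi u hu).1 hBu v hv', hc v (Ioo_subset_Ioo (neg_le_neg hle) hle hv')]
  · exact hreg v (Ioo_subset_Ioo (neg_le_neg (min_le_right _ _)) (min_le_right _ _) hv) i
      (Finset.mem_range.2 hi) u hu
  · have h0 : (0 : ℝ) ∈ Ioo (-min δ₂ ε) (min δ₂ ε) := by simpa using hδ
    refine (velocity_eq_deriv_self h0 (hx.contMDiffAt_slice hi hu h0)).trans ?_
    rw [hx.2 i hi u hu]
    exact hx₂V i hi u hu
  · exact (accelField_eq_centralAccel hδ hx ht hσ.1 hi hu (hx₂V i hi u hu)).trans (hx₂A i hi u hu)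

end Variation

end Finsler

end

theorem lemma6p7
    {E : Type*} [NormedAddCommGroup E] [NormedSpace ℝ E] [FiniteDimensional ℝ E]
    {M : Type*} [TopologicalSpace M] [T2Space M] [SecondCountableTopology M] [ConnectedSpace M]
    [ChartedSpace E M] [IsManifold 𝓘(ℝ, E) ∞ M]
    (F : Finsler.FinslerSpacetime E M) (a b : ℝ) (hab : a < b)
    (σ : ℝ → M) (hσ : F.IsGeodesic σ a b)
    (k : ℕ) (t : ℕ → ℝ) (ht : Finsler.IsPartition a b k t)
    (V A : (u : ℝ) → TangentSpace 𝓘(ℝ, E) (σ u))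
    (hV : Finsler.IsPiecewiseSmoothField σ k t V)
    (hA : Finsler.IsPiecewiseSmoothField σ k t A)
    (hVa : V a = 0) (hVb : V b = 0) (hAa : A a = 0) (hAb : A b = 0) :
    ∃ (δ : ℝ) (x : ℝ × ℝ → M), 0 < δ ∧
      Finsler.IsPiecewiseSmoothVariation E σ k t δ x ∧
      -- the endpoints are fixed
      (∀ v ∈ Set.Ioo (-δ) δ, x (a, v) = σ a ∧ x (b, v) = σ b) ∧
      ∀ i < k, ∀ u ∈ Finsler.piece t i,
        -- the velocities of the longitudinal curves are admissible as reference vectors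
        (∀ v ∈ Set.Ioo (-δ) δ,
          (⟨x (u, v), Finsler.longVelocity x (Finsler.piece t i) u v⟩ :
            TangentBundle 𝓘(ℝ, E) M) ∈ F.Astar ∧
          Finsler.IsRegularAt F.L
            (⟨x (u, v), Finsler.longVelocity x (Finsler.piece t i) u v⟩ :
              TangentBundle 𝓘(ℝ, E) M)) ∧
        -- the variation field is `V`
        (⟨x (u, 0), Finsler.transVelocity x δ u 0⟩ : TangentBundle 𝓘(ℝ, E) M) = ⟨σ u, V u⟩ ∧
        -- the acceleration field is `A`
        (⟨x (u, 0), Finsler.accelField F.L x (Finsler.piece t i) δ u⟩ :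
          TangentBundle 𝓘(ℝ, E) M) = ⟨σ u, A u⟩ := by
  obtain ⟨δ, x, hδ, hx, hfix, h⟩ := Finsler.exists_variation hab hσ ht hV hA
  obtain ⟨h0, hk, hlt⟩ := ht
  -- `k = 0` would force `a = b`. Hence `a` lies in piece `0` and `b` in piece `k - 1`.
  have hkpos : 0 < k := by
    rcases Nat.eq_zero_or_pos k with rfl | h
    · rw [h0] at hk
      exact absurd hk hab.ne
    · exact h
  refine ⟨δ, x, hδ, hx, fun v hv => ⟨?_, ?_⟩, h⟩
  · refine hfix 0 hkpos a ?_ hVa hAa v hv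
    rw [← h0]
    exact left_mem_Icc.2 (hlt 0 hkpos).le
  · have hk1 : k - 1 < k := Nat.sub_lt hkpos one_pos
    refine hfix (k - 1) hk1 b ?_ hVb hAb v hv
    rw [Finsler.piece, Nat.sub_add_cancel hkpos, hk]
    have := (hlt (k - 1) hk1).le
    rw [Nat.sub_add_cancel hkpos, hk] at this
    exact right_mem_Icc.2 this
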